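/- Let $PB_N$ be the pure braid group of the disk on $N$ strands. A morphism $\Phi\in\mathrm{Hom}_{\mathrm{PaB}(3)}((12)3,1(23))$ of parenthesized braids is the same as an arbitrary pure braid $\Phi\in PB_3$. Put $$\mathrm{Pent}(\Phi)=\Phi^{2,3,4}\,\Phi^{1,23,4}\,\Phi^{1,2,3}\,(\Phi^{12,3,4})^{-1}(\Phi^{1,2,34})^{-1}\in PB_4,$$ where $\Phi^{1,2,3}$ and $\Phi^{2,3,4}$ are obtained from $\Phi$ by adding a trivial strand on the right, respectively on the left, and $\Phi^{12,3,4},\Phi^{1,23,4},\Phi^{1,2,34}$ by replacing the first, second, third strand by two parallel strands; products of braids are composed from right to left. Let $n\ge 0$ and $m\ge 1$ be integers with $n+m=4$. Let $F_{m+n-1}=F_3\le PB_4$ be the kernel of the deletion of the fourth strand $PB_4\to PB_3$. It is free on $x_1,x_2,x_3$, where $x_j=A_{j4}$ is the standard pure braid in which the fourth strand encircles the $j$-th one. Let $\mathrm{Brun}_{n,m}(D)\le PB_4$ be the group of the pure braids that become trivial after deleting any one of the strands $n+1,\dots,n+m$. Let $\Gamma_1(F_3)=F_3$ and $\Gamma_{k+1}(F_3)=[F_3,\Gamma_k(F_3)]$.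 Let $\mathcal M:F_3\to\mathbb Z\langle\langle X_1,X_2,X_3\rangle\rangle$ be the Magnus expansion $x_j\mapsto 1+X_j$, and for $1\le i\le 3$ let $\mathrm{pr}^i:\mathbb Z\langle\langle X_1,X_2,X_3\rangle\rangle\to\mathbb Z\langle\langle X_1,X_2\rangle\rangle$ be the ring homomorphism given by $X_i\mapsto 0$, $X_j\mapsto X_j$ for $j<i$ and $X_j\mapsto X_{j-1}$ for $j>i$. Then for every such $\Phi$ and every integer $k\ge 1$ the following are equivalent: 1. $\mathrm{Pent}(\Phi)$ lies in $\Gamma_k(F_3)\cap \mathrm{Brun}_{n,m}(D)$ but not in $\Gamma_{k+1}(F_3)\cap \mathrm{Brun}_{n,m}(D)$; 2. $\mathrm{Pent}(\Phi)$ lies in $F_3$, and $\mathcal M(\mathrm{Pent}(\Phi))-1$ starts in degree $k$ with a term $\phi_k$ (its homogeneous components of degree less than $k$ vanish and that of degree $k$ is $\phi_k\ne 0$) such that $\phi_k\in\bigcap_{i=n+1}^{n+m-1}\ker \mathrm{pr}^i$. -/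

import Mathlib

/-- The defining relations of Artin's braid group on `n` strands, in the generators
`σ_0, …, σ_{n-2}`. -/
def braidRels (n : ℕ) : Set (FreeGroup (Fin (n - 1))) :=
  {r | ∃ i j : Fin (n - 1), (i : ℕ) + 2 ≤ j ∧
      r = FreeGroup.of i * FreeGroup.of j * (FreeGroup.of j * FreeGroup.of i)⁻¹} ∪
  {r | ∃ i j : Fin (n - 1), (j : ℕ) = i + 1 ∧
      r = FreeGroup.of i * FreeGroup.of j * FreeGroup.of i *
        (FreeGroup.of j * FreeGroup.of i * FreeGroup.of j)⁻¹}

/-- Artin's braid group `B_n` of the disk. Products are composed from right to left: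
in `β * α` the braid `α` comes first. Strand positions are `0, …, n-1`. -/
abbrev Braid (n : ℕ) : Type := PresentedGroup (braidRels n)

namespace Braid

/-- The Artin generator `σ_i`, crossing positions `i` and `i+1` (for `i + 1 < n`;
by convention `1` for other `i`). -/
def s (n i : ℕ) : Braid n :=
  if h : i < n - 1 then PresentedGroup.of ⟨i, h⟩ else 1

theorem s_comm {n i j : ℕ} (hij : i + 2 ≤ j) : s n i * s n j = s n j * s n i := by
  unfold s
  by_cases hj : j < n - 1
  · have hi : i < n - 1 := by omega
    simp only [hi, hj, dif_pos]
    exact PresentedGroup.mk_eq_mk_of_mul_inv_mem (rels := braidRels n)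
      (x := FreeGroup.of ⟨i, hi⟩ * FreeGroup.of ⟨j, hj⟩)
      (y := FreeGroup.of ⟨j, hj⟩ * FreeGroup.of ⟨i, hi⟩)
      (Or.inl ⟨⟨i, hi⟩, ⟨j, hj⟩, hij, rfl⟩)
  · simp [hj]

theorem s_braid {n i : ℕ} (hi : i + 2 < n) :
    s n i * s n (i + 1) * s n i = s n (i + 1) * s n i * s n (i + 1) := by
  have h1 : i < n - 1 := by omega
  have h2 : i + 1 < n - 1 := by omega
  unfold s
  simp only [h1, h2, dif_pos]
  exact PresentedGroup.mk_eq_mk_of_mul_inv_mem (rels := braidRels n)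
    (x := FreeGroup.of ⟨i, h1⟩ * FreeGroup.of ⟨i + 1, h2⟩ * FreeGroup.of ⟨i, h1⟩)
    (y := FreeGroup.of ⟨i + 1, h2⟩ * FreeGroup.of ⟨i, h1⟩ * FreeGroup.of ⟨i + 1, h2⟩)
    (Or.inr ⟨⟨i, h1⟩, ⟨i + 1, h2⟩, rfl, rfl⟩)

/-- A homomorphism out of `B_n` is given by images `f i` of the `σ_i` satisfying the
braid relations. -/
def lift {G : Type*} [Group G] {n : ℕ} (f : ℕ → G)
    (h1 : ∀ i j, i + 2 ≤ j → j + 1 < n → f i * f j = f j * f i)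
    (h2 : ∀ i, i + 2 < n → f i * f (i + 1) * f i = f (i + 1) * f i * f (i + 1)) :
    Braid n →* G :=
  PresentedGroup.toGroup (f := fun i : Fin (n - 1) => f i) (by
    rintro r (⟨i, j, hij, rfl⟩ | ⟨i, j, hij, rfl⟩)
    · have := h1 i j hij (by omega)
      simp [this]
    · have := h2 i (by omega)
      simp [hij, this])

theorem lift_s {G : Type*} [Group G] {n : ℕ} (f : ℕ → G)
    (h1 : ∀ i j, i + 2 ≤ j → j + 1 < n → f i * f j = f j * f i)
    (h2 : ∀ i, i + 2 < n → f i * f (i + 1) * f i = f (i + 1) * f i * f (i + 1))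
    {i : ℕ} (hi : i + 1 < n) : lift f h1 h2 (s n i) = f i := by
  have h : i < n - 1 := by omega
  simp [lift, s, h]

/-- Induction principle: a subset of `B_n` closed under products and inverses and containing
all the `σ_i` is everything. -/
theorem induction {n : ℕ} {P : Braid n → Prop} (one : P 1)
    (gen : ∀ i, i + 1 < n → P (s n i)) (mul : ∀ a b, P a → P b → P (a * b))
    (inv : ∀ a, P a → P a⁻¹) (β : Braid n) : P β := by
  have hβ : β ∈ Subgroup.closure (Set.range (PresentedGroup.of (rels := braidRels n))) := by
    rw [PresentedGroup.closure_range_of]; trivial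
  refine Subgroup.closure_induction ?_ one (fun a b _ _ => mul a b) (fun a _ => inv a) hβ
  rintro _ ⟨i, rfl⟩
  have := gen i (by omega)
  simpa [s] using this

/-- The transposition of the positions `i` and `i + 1` (the identity if `i + 1 ≥ n`). -/
def tr (n i : ℕ) : Equiv.Perm (Fin n) :=
  if h : i + 1 < n then Equiv.swap ⟨i, by omega⟩ ⟨i + 1, h⟩ else 1

theorem tr_val {n i : ℕ} (h : i + 1 < n) (q : Fin n) :
    (tr n i q : ℕ) = if (q : ℕ) = i then i + 1 else if (q : ℕ) = i + 1 then i else q := by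
  simp only [tr, h, dif_pos, Equiv.swap_apply_def, Fin.ext_iff]
  split_ifs <;> rfl

/-- The transposition of `i` and `i + 1` on natural numbers. -/
def trN (i q : ℕ) : ℕ := if q = i then i + 1 else if q = i + 1 then i else q

theorem tr_val' {n i : ℕ} (h : i + 1 < n) (q : Fin n) : (tr n i q : ℕ) = trN i q := tr_val h q

theorem trN_lt {i q : ℕ} (h : q < i) : trN i q = q := by
  unfold trN; split_ifs <;> omega

theorem trN_left {i : ℕ} : trN i i = i + 1 := by simp [trN]

theorem trN_right {i : ℕ} : trN i (i + 1) = i := by simp [trN]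

theorem trN_gt {i q : ℕ} (h : i + 1 < q) : trN i q = q := by
  unfold trN; split_ifs <;> omega

theorem tr_inv (n i : ℕ) : (tr n i)⁻¹ = tr n i := by
  unfold tr; split_ifs <;> simp

theorem tr_comm {n i j : ℕ} (hij : i + 2 ≤ j) (hj : j + 1 < n) :
    tr n i * tr n j = tr n j * tr n i := by
  ext q
  simp only [Equiv.Perm.mul_apply, tr_val hj, tr_val (show i + 1 < n by omega)]
  split_ifs <;> omega

theorem tr_braid {n i : ℕ} (hi : i + 2 < n) :
    tr n i * tr n (i + 1) * tr n i = tr n (i + 1) * tr n i * tr n (i + 1) := by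
  ext q
  simp only [Equiv.Perm.mul_apply, tr_val (show i + 1 < n by omega),
    tr_val (show i + 1 + 1 < n by omega)]
  split_ifs <;> omega

/-- The permutation of a braid: the strand starting at position `p` ends at `perm n β p`. -/
def perm (n : ℕ) : Braid n →* Equiv.Perm (Fin n) :=
  lift (tr n) (fun _ _ => tr_comm) (fun _ => tr_braid)

theorem perm_s {n i : ℕ} (hi : i + 1 < n) : perm n (s n i) = tr n i := lift_s _ _ _ hi

/-- Families `g` of elements of `G` indexed by end positions together with a permutation; the
product is `(g, π) * (h, ρ) = (q ↦ g q * h (π⁻¹ q), π * ρ)`. An operation `β ↦ g q` depending on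
the strand of `β` that ends at position `q`, compatible with stacking of braids, is a homomorphism
from the braid group to this group. -/
abbrev Wreath (G : Type) [Group G] (n : ℕ) : Type :=
  (Fin n → G) ⋊[mulAutArrow] Equiv.Perm (Fin n)

/-- `lift` to `Wreath`, with the relations spelled out in coordinates. -/
def liftW {G : Type} [Group G] {n : ℕ} (f : ℕ → ℕ → G)
    (h1 : ∀ i j q, i + 2 ≤ j → j + 1 < n → q < n →
      f i q * f j (trN i q) = f j q * f i (trN j q))
    (h2 : ∀ i q, i + 2 < n → q < n →
      f i q * f (i + 1) (trN i q) * f i (trN (i + 1) (trN i q)) =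
      f (i + 1) q * f i (trN (i + 1) q) * f (i + 1) (trN i (trN (i + 1) q))) :
    Braid n →* Wreath G n :=
  lift (fun i => ⟨fun q => f i q, tr n i⟩)
    (fun i j hij hj => by
      refine SemidirectProduct.ext (funext fun q => ?_) (tr_comm hij hj)
      have := h1 i j q hij hj q.2
      rw [← tr_val' (show i + 1 < n by omega), ← tr_val' hj, ← tr_inv n i, ← tr_inv n j] at this
      exact this)
    (fun i hi => by
      refine SemidirectProduct.ext (funext fun q => ?_) (tr_braid hi)
      have := h2 i q hi q.2
      simp only [← tr_val' (show i + 1 < n by omega),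
        ← tr_val' (show i + 1 + 1 < n by omega)] at this
      change _ * f (i + 1) ((tr n i)⁻¹ q : Fin n) * f i ((tr n i * tr n (i + 1))⁻¹ q : Fin n) =
        _ * f i ((tr n (i + 1))⁻¹ q : Fin n) * f (i + 1) ((tr n (i + 1) * tr n i)⁻¹ q : Fin n)
      rw [mul_inv_rev, mul_inv_rev, tr_inv, tr_inv]
      exact this)

theorem liftW_s {G : Type} [Group G] {n : ℕ} (f : ℕ → ℕ → G) (h1) (h2) {i : ℕ} (hi : i + 1 < n) :
    liftW (n := n) f h1 h2 (s n i) = ⟨fun q => f i q, tr n i⟩ :=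
  lift_s _ _ _ hi

theorem liftW_right {G : Type} [Group G] {n : ℕ} (f : ℕ → ℕ → G) (h1) (h2) (β : Braid n) :
    (liftW (n := n) f h1 h2 β).right = perm n β := by
  induction β using Braid.induction with
  | one => simp
  | gen i hi => rw [liftW_s _ _ _ hi, perm_s hi]
  | mul a b ha hb => simp [ha, hb]
  | inv a ha => simp [ha]

/-- Deleting from `σ_i` the strand that ends at position `q`. -/
def delGen (n i q : ℕ) : Braid n :=
  if q < i then s n (i - 1) else if q ≤ i + 1 then 1 else s n i

theorem delGen_lt {n i q : ℕ} (h : q < i) : delGen n i q = s n (i - 1) := by simp [delGen, h]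

theorem delGen_mid {n i q : ℕ} (h1 : i ≤ q) (h2 : q ≤ i + 1) : delGen n i q = 1 := by
  simp [delGen, h2, show ¬ q < i by omega]

theorem delGen_gt {n i q : ℕ} (h : i + 1 < q) : delGen n i q = s n i := by
  simp [delGen, show ¬ q ≤ i + 1 by omega, show ¬ q < i by omega]

/-- Deletion of a strand from a braid: the first component at `q` of the image of `β` is
`β` without the strand ending at position `q`. -/
def del (n : ℕ) : Braid (n + 1) →* Wreath (Braid n) (n + 1) :=
  liftW (delGen n)
    (fun i j q hij hj hq => by
      rcases (by omega : q < i ∨ q = i ∨ q = i + 1 ∨ (i + 1 < q ∧ q < j) ∨ q = j ∨ q = j + 1 ∨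
        j + 1 < q) with h | rfl | rfl | h | rfl | rfl | h
      all_goals
        simp (disch := omega) only [trN_lt, trN_gt, trN_left, trN_right, delGen_lt, delGen_mid,
          delGen_gt, one_mul, mul_one]
      all_goals exact s_comm (by omega))
    (fun i q hi hq => by
      rcases (by omega : q < i ∨ q = i ∨ q = i + 1 ∨ q = i + 2 ∨ i + 2 < q) with
        h | rfl | rfl | rfl | h
      · have := s_braid (n := n) (i := i - 1) (by omega)
        rw [show i - 1 + 1 = i by omega] at this
        simp (disch := omega) only [trN_lt, delGen_lt]
        simpa using this
      all_goals
        simp (disch := omega) only [trN_lt, trN_gt, trN_left, trN_right, delGen_lt, delGen_mid,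
          delGen_gt, one_mul, mul_one, Nat.add_sub_cancel]
      exact s_braid (by omega))

/-- Doubling in `σ_i` the strand that ends at position `q` (the two copies run in parallel). -/
def dblGen (n i q : ℕ) : Braid (n + 1) :=
  if q < i then s (n + 1) (i + 1)
  else if q = i then s (n + 1) (i + 1) * s (n + 1) i
  else if q = i + 1 then s (n + 1) i * s (n + 1) (i + 1)
  else s (n + 1) i

theorem dblGen_lt {n i q : ℕ} (h : q < i) : dblGen n i q = s (n + 1) (i + 1) := by
  simp [dblGen, h]

theorem dblGen_left {n i : ℕ} : dblGen n i i = s (n + 1) (i + 1) * s (n + 1) i := by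
  simp [dblGen]

theorem dblGen_right {n i : ℕ} : dblGen n i (i + 1) = s (n + 1) i * s (n + 1) (i + 1) := by
  simp [dblGen]

theorem dblGen_gt {n i q : ℕ} (h : i + 1 < q) : dblGen n i q = s (n + 1) i := by
  simp [dblGen, show ¬ q < i by omega, show q ≠ i by omega, show q ≠ i + 1 by omega]

/-- Doubling of a strand of a braid: the first component at `q` of the image of `β` is `β` with
the strand ending at position `q` replaced by two parallel strands (with no twist). -/
def dbl (n : ℕ) : Braid n →* Wreath (Braid (n + 1)) n :=
  liftW (dblGen n)
    (fun i j q hij hj hq => by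
      have a1 : Commute (s (n + 1) i) (s (n + 1) j) := s_comm hij
      have a2 : Commute (s (n + 1) i) (s (n + 1) (j + 1)) := s_comm (by omega)
      have a3 : Commute (s (n + 1) (i + 1)) (s (n + 1) (j + 1)) := s_comm (by omega)
      rcases (by omega : q < i ∨ q = i ∨ q = i + 1 ∨ (i + 1 < q ∧ q < j) ∨ q = j ∨ q = j + 1 ∨
        j + 1 < q) with h | rfl | rfl | h | rfl | rfl | h
      all_goals
        simp (disch := omega) only [trN_lt, trN_gt, trN_left, trN_right, dblGen_lt, dblGen_left,
          dblGen_right, dblGen_gt]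
      · exact a3
      · exact a3.mul_left a2
      · exact a2.mul_left a3
      · exact a2
      · exact a2.mul_right a1
      · exact a1.mul_right a2
      · exact a1)
    (fun i q hi hq => by
      have b1 := s_braid (n := n + 1) (i := i) (by omega)
      have b2 := s_braid (n := n + 1) (i := i + 1) (by omega)
      have c : s (n + 1) i * s (n + 1) (i + 2) = _ := s_comm le_rfl
      rw [add_assoc] at b2
      norm_num at b2
      generalize ha : s (n + 1) i = a at *
      generalize hb : s (n + 1) (i + 1) = b at *
      generalize hd : s (n + 1) (i + 2) = d at *
      rcases (by omega : q < i ∨ q = i ∨ q = i + 1 ∨ q = i + 1 + 1 ∨ i + 2 < q) with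
        h | rfl | rfl | rfl | h
      all_goals
        simp (disch := omega) only [trN_lt, trN_gt, trN_left, trN_right, dblGen_lt, dblGen_left,
          dblGen_right, dblGen_gt, ha, hb, hd, add_assoc, Nat.reduceAdd]
      · exact b2
      · calc b * a * (d * b) * a = b * (a * d) * b * a := by group
          _ = b * d * (a * b * a) := by rw [c]; group
          _ = (b * d * b) * a * b := by rw [b1]; group
          _ = d * b * (d * a) * b := by rw [b2]; group
          _ = _ := by rw [← c]; group
      · calc a * b * d * (b * a) = a * (b * d * b) * a := by group
          _ = (a * d) * b * (d * a) := by rw [b2]; group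
          _ = d * a * b * (d * a) := by rw [c]
          _ = d * (a * b * a) * d := by
            rw [show d * (a * b * a) * d = d * a * b * (a * d) by group, c]
          _ = _ := by rw [b1]; group
      · calc a * (b * d) * (a * b) = a * b * (d * a) * b := by group
          _ = (a * b * a) * d * b := by rw [← c]; group
          _ = b * a * (b * d * b) := by rw [b1]; group
          _ = b * (a * d) * b * d := by rw [b2]; group
          _ = _ := by rw [c]; group
      · exact b1)

/-- Adding a strand on the right of all others. -/
def addRight (n : ℕ) : Braid n →* Braid (n + 1) :=
  lift (fun i => s (n + 1) i) (fun _ _ hij _ => s_comm hij) (fun _ hi => s_braid (by omega))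

/-- Adding a strand on the left of all others. -/
def addLeft (n : ℕ) : Braid n →* Braid (n + 1) :=
  lift (fun i => s (n + 1) (i + 1)) (fun _ _ hij _ => s_comm (by omega))
    (fun _ hi => s_braid (by omega))

theorem succAbove_val {n : ℕ} (q : Fin (n + 1)) (r : Fin n) :
    (q.succAbove r : ℕ) = if (r : ℕ) < q then (r : ℕ) else r + 1 := by
  simp only [Fin.succAbove, Fin.lt_def, Fin.val_castSucc]
  split_ifs <;> simp

theorem left_mul {G : Type} [Group G] {n : ℕ} (x y : Wreath G n) (q : Fin n) :
    (x * y).left q = x.left q * y.left (x.right⁻¹ q) := rfl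

theorem left_inv {G : Type} [Group G] {n : ℕ} (x : Wreath G n) (q : Fin n) :
    (x⁻¹).left q = (x.left (x.right q))⁻¹ := by
  change (x.left ((x.right⁻¹)⁻¹ q))⁻¹ = _
  rw [inv_inv]

theorem del_right {n : ℕ} (β : Braid (n + 1)) : (del n β).right = perm (n + 1) β :=
  liftW_right _ _ _ β

theorem dbl_right {n : ℕ} (β : Braid n) : (dbl n β).right = perm n β :=
  liftW_right _ _ _ β

theorem del_s {n i : ℕ} (hi : i < n) (q : Fin (n + 1)) :
    (del n (s (n + 1) i)).left q = delGen n i q := by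
  unfold del; rw [liftW_s _ _ _ (by omega)]

theorem dbl_s {n i : ℕ} (hi : i + 1 < n) (q : Fin n) :
    (dbl n (s n i)).left q = dblGen n i q := by
  unfold dbl; rw [liftW_s _ _ _ hi]

/-- The permutation of a braid with one strand removed. -/
theorem perm_del {n : ℕ} (β : Braid (n + 1)) : ∀ (q : Fin (n + 1)) (r : Fin n),
    q.succAbove (perm n ((del n β).left q) r) =
      perm (n + 1) β (((perm (n + 1) β)⁻¹ q).succAbove r) := by
  induction β using Braid.induction with
  | one => simp
  | gen i hi =>
    intro q r
    rw [del_s (by omega), perm_s hi, tr_inv]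
    ext
    rw [tr_val hi, succAbove_val, succAbove_val, tr_val hi]
    have hq := q.2
    have hr := r.2
    rcases (by omega : (q : ℕ) < i ∨ (q : ℕ) = i ∨ (q : ℕ) = i + 1 ∨ i + 1 < (q : ℕ)) with
      h | h | h | h
    · rw [delGen_lt h, perm_s (by omega), tr_val (by omega)]
      split_ifs <;> omega
    · rw [delGen_mid (by omega) (by omega)]
      simp only [map_one, Equiv.Perm.one_apply]
      split_ifs <;> omega
    · rw [delGen_mid (by omega) (by omega)]
      simp only [map_one, Equiv.Perm.one_apply]
      split_ifs <;> omega
    · rw [delGen_gt h, perm_s (by omega), tr_val (by omega)]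
      split_ifs <;> omega
  | mul a b ha hb =>
    intro q r
    rw [map_mul, left_mul, del_right, map_mul, map_mul, Equiv.Perm.mul_apply, ha, hb,
      mul_inv_rev, Equiv.Perm.mul_apply, Equiv.Perm.mul_apply]
  | inv a ha =>
    intro q r
    have h := ha (perm (n + 1) a q) ((perm n ((del n a).left (perm (n + 1) a q)))⁻¹ r)
    rw [map_inv, left_inv, del_right, map_inv, map_inv, inv_inv]
    simp only [Equiv.Perm.inv_def, Equiv.apply_symm_apply, Equiv.symm_apply_apply] at h ⊢
    rw [h, Equiv.symm_apply_apply]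

/-- The permutation of a braid with one strand doubled: omitting either copy gives the original
permutation. -/
theorem perm_dbl {n : ℕ} (e : Fin n → Fin n → Fin (n + 1))
    (he : e = (fun q => q.succ.succAbove) ∨ e = (fun q => q.castSucc.succAbove)) (β : Braid n) :
    ∀ (q r : Fin n), perm (n + 1) ((dbl n β).left q) (e ((perm n β)⁻¹ q) r) =
      e q (perm n β r) := by
  induction β using Braid.induction with
  | one => simp
  | gen i hi =>
    intro q r
    rw [dbl_s hi, perm_s hi, tr_inv]
    have hq := q.2
    have hr := r.2
    have h1 : i + 1 < n + 1 := by omega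
    have h2 : i + 1 + 1 < n + 1 := by omega
    rcases he with rfl | rfl <;> ext
    all_goals
      rcases (by omega : (q : ℕ) < i ∨ (q : ℕ) = i ∨ (q : ℕ) = i + 1 ∨ i + 1 < (q : ℕ)) with
        h | h | h | h
    all_goals
      first
      | rw [dblGen_lt h]
      | rw [h, dblGen_left]
      | rw [h, dblGen_right]
      | rw [dblGen_gt h]
      simp only [map_mul, Equiv.Perm.mul_apply, perm_s h1, perm_s h2, tr_val h1, tr_val h2,
        succAbove_val, tr_val hi, Fin.val_succ, Fin.val_castSucc, h]
      clear * - hq hr h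
      grind
  | mul a b ha hb =>
    intro q r
    rw [map_mul, left_mul, dbl_right, map_mul, map_mul, mul_inv_rev, Equiv.Perm.mul_apply,
      Equiv.Perm.mul_apply, hb, ha, Equiv.Perm.mul_apply]
  | inv a ha =>
    intro q r
    have h := ha (perm n a q) ((perm n a)⁻¹ r)
    rw [map_inv, left_inv, dbl_right, map_inv, map_inv, inv_inv]
    simp only [Equiv.Perm.inv_def, Equiv.apply_symm_apply, Equiv.symm_apply_apply] at h ⊢
    rw [← h, Equiv.symm_apply_apply]

end Braid

/-- The pure braid group `PB_n` of the disk: the braids each of whose strands ends where it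
starts. -/
abbrev PureBraid (n : ℕ) : Type := (Braid.perm n).ker

namespace PureBraid

open Braid

theorem perm_eq_one {n : ℕ} (β : PureBraid n) : perm n (β : Braid n) = 1 := β.2

theorem left_mul {G : Type} [Group G] {n m : ℕ} (W : Braid n →* Wreath G m)
    (a b : Braid n) (ha : (W a).right = 1) (q : Fin m) :
    (W (a * b)).left q = (W a).left q * (W b).left q := by
  rw [map_mul, Braid.left_mul, ha]; rfl

/-- `delete q : PB_{n+1} → PB_n` deletes the strand at position `q`. -/
def delete {n : ℕ} (q : Fin (n + 1)) : PureBraid (n + 1) →* PureBraid n where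
  toFun β := ⟨(del n β).left q, by
    refine Equiv.ext fun r => Fin.succAbove_right_injective (p := q) ?_
    rw [perm_del, perm_eq_one]; rfl⟩
  map_one' := Subtype.ext (by simp)
  map_mul' a b := Subtype.ext
    (left_mul (del n) a b (by rw [del_right, perm_eq_one]) q)

/-- `double q : PB_n → PB_{n+1}` replaces the strand at position `q` by two parallel strands. -/
def double {n : ℕ} (q : Fin n) : PureBraid n →* PureBraid (n + 1) where
  toFun β := ⟨(dbl n β).left q, by
    have h1 := fun r => perm_dbl _ (Or.inl rfl) (β : Braid n) q r
    have h2 := fun r => perm_dbl _ (Or.inr rfl) (β : Braid n) q r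
    simp only [perm_eq_one, inv_one, Equiv.Perm.one_apply] at h1 h2
    refine Equiv.ext fun x => ?_
    by_cases hx : x = q.succ
    · have hne : x ≠ q.castSucc := by
        rw [hx]; exact fun h => absurd (congrArg Fin.val h) (by simp)
      obtain ⟨r, rfl⟩ := Fin.exists_succAbove_eq hne
      exact h2 r
    · obtain ⟨r, rfl⟩ := Fin.exists_succAbove_eq hx
      exact h1 r⟩
  map_one' := Subtype.ext (by simp)
  map_mul' a b := Subtype.ext
    (left_mul (dbl n) a b (by rw [dbl_right, perm_eq_one]) q)

/-- Adding a trivial strand on the right. -/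
def addRight {n : ℕ} : PureBraid n →* PureBraid (n + 1) :=
  (((Braid.addRight n).comp (perm n).ker.subtype).codRestrict (perm (n + 1)).ker (by
    have key : ∀ β : Braid n, (∀ r : Fin n, perm (n + 1) (Braid.addRight n β) r.castSucc =
        (perm n β r).castSucc) ∧
        perm (n + 1) (Braid.addRight n β) (Fin.last n) = Fin.last n := by
      intro β
      induction β using Braid.induction with
      | one => simp
      | gen i hi =>
        have h1 : i + 1 < n + 1 := by omega
        have hs : Braid.addRight n (s n i) = s (n + 1) i := lift_s _ _ _ hi
        rw [hs, perm_s h1, perm_s hi]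
        refine ⟨fun r => Fin.ext ?_, Fin.ext ?_⟩
        · rw [tr_val h1, Fin.val_castSucc, Fin.val_castSucc, tr_val hi]
        · rw [tr_val h1, Fin.val_last]
          split_ifs <;> omega
      | mul a b ha hb => simp [ha.1, ha.2, hb.1, hb.2]
      | inv a ha =>
        simp only [map_inv]
        refine ⟨fun r => ?_, ?_⟩
        · rw [Equiv.Perm.inv_eq_iff_eq, ha.1]; simp
        · rw [Equiv.Perm.inv_eq_iff_eq, ha.2]
    intro β
    refine Equiv.ext fun x => ?_
    have hβ := perm_eq_one β
    refine Fin.lastCases ?_ (fun r => ?_) x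
    · exact (key β).2
    · exact ((key β).1 r).trans (by rw [hβ]; rfl)))

/-- Adding a trivial strand on the left. -/
def addLeft {n : ℕ} : PureBraid n →* PureBraid (n + 1) :=
  (((Braid.addLeft n).comp (perm n).ker.subtype).codRestrict (perm (n + 1)).ker (by
    have key : ∀ β : Braid n, (∀ r : Fin n, perm (n + 1) (Braid.addLeft n β) r.succ =
        (perm n β r).succ) ∧ perm (n + 1) (Braid.addLeft n β) 0 = 0 := by
      intro β
      induction β using Braid.induction with
      | one => simp
      | gen i hi =>
        have h1 : i + 1 + 1 < n + 1 := by omega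
        have hs : Braid.addLeft n (s n i) = s (n + 1) (i + 1) := lift_s _ _ _ hi
        rw [hs, perm_s h1, perm_s hi]
        refine ⟨fun r => Fin.ext ?_, Fin.ext ?_⟩
        · rw [tr_val h1, Fin.val_succ, Fin.val_succ, tr_val hi]
          split_ifs <;> omega
        · rw [tr_val h1, Fin.val_zero]
          split_ifs <;> omega
      | mul a b ha hb => simp [ha.1, ha.2, hb.1, hb.2]
      | inv a ha =>
        simp only [map_inv]
        refine ⟨fun r => ?_, ?_⟩
        · rw [Equiv.Perm.inv_eq_iff_eq, ha.1]; simp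
        · rw [Equiv.Perm.inv_eq_iff_eq, ha.2]
    intro β
    refine Equiv.ext fun x => ?_
    have hβ := perm_eq_one β
    refine Fin.cases ?_ (fun r => ?_) x
    · exact (key β).2
    · exact ((key β).1 r).trans (by rw [hβ]; rfl)))

/-- The kernel of the deletion of the last strand `PB_{n+1} → PB_n` (a free group of
rank `n`). -/
def freeKernel (n : ℕ) : Subgroup (PureBraid (n + 1)) := (delete (Fin.last n)).ker

/-- `Γ k S` is the `k`-th term of the lower central series of a subgroup `S`, with
`Γ_1 = S` and `Γ_{k+1} = [S, Γ_k]`; it is only used for `k ≥ 1`. -/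
def Γ {G : Type} [Group G] (k : ℕ) (S : Subgroup G) : Subgroup G := S.lowerCentralSeries (k - 1)

/-- The mixed Brunnian braids `Brun_{n,m}` on `N + 1 = n + m` strands with `n` fixed strands: the
pure braids that become trivial after deleting any one of the last `m` strands (those at the
positions `n, …, N`). -/
def mixedBrunnian (n m : ℕ) {N : ℕ} (_h : n + m = N + 1) : Subgroup (PureBraid (N + 1)) :=
  ⨅ q : {q : Fin (N + 1) // n ≤ (q : ℕ)}, (delete q.1).ker

/-- The standard pure braid `A_{j,n}` on the strands `0, …, n` in which only the last strand
moves: it encircles the strand `j` once, passing on the same side of all the strands between. -/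
def lastGen (n : ℕ) (j : Fin n) : PureBraid (n + 1) :=
  let c : Braid (n + 1) := ((List.range' (j + 1) (n - 1 - j)).reverse.map (s (n + 1))).prod
  ⟨c * (s (n + 1) j * s (n + 1) j) * c⁻¹, by
    rw [MonoidHom.mem_ker, map_mul, map_mul, map_mul, perm_s (by omega)]
    have : tr (n + 1) j * tr (n + 1) j = 1 := by
      nth_rewrite 1 [← tr_inv]; exact inv_mul_cancel _
    rw [this, mul_one, map_inv, mul_inv_cancel]⟩

/-- The homomorphism from the free group on `x_0, …, x_{n-1}` onto `freeKernel n`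
with `x_j ↦ A_{j,n}`. -/
def ofFree (n : ℕ) : FreeGroup (Fin n) →* PureBraid (n + 1) := FreeGroup.lift (lastGen n)

end PureBraid

/-- An object of `PaB(n)`: a parenthesization of `n` points together with a labelling of the
positions by the strand labels. -/
structure PaB (n : ℕ) where
  shape : FreeMagma Unit
  length_eq : shape.length = n
  label : Equiv.Perm (Fin n)

namespace PaB

/-- Morphisms of `PaB(n)`: the braids connecting points with equal labels. -/
def Hom {n : ℕ} (x y : PaB n) : Type :=
  {β : Braid n // ∀ p, y.label (Braid.perm n β p) = x.label p}

/-- The object `(12)3` of `PaB(3)`. -/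
def left3 : PaB 3 := ⟨(.of () * .of ()) * .of (), rfl, 1⟩

/-- The object `1(23)` of `PaB(3)`. -/
def right3 : PaB 3 := ⟨.of () * (.of () * .of ()), rfl, 1⟩

/-- The underlying pure braid of a morphism from `(12)3` to `1(23)`. -/
def toPure (Φ : Hom left3 right3) : PureBraid 3 := ⟨Φ.1, Equiv.ext Φ.2⟩

/-- The pentagon braid
`Φ^{2,3,4} Φ^{1,23,4} Φ^{1,2,3} (Φ^{12,3,4})⁻¹ (Φ^{1,2,34})⁻¹`. -/
def Pent (Φ : Hom left3 right3) : PureBraid 4 :=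
  PureBraid.addLeft (toPure Φ) * PureBraid.double 1 (toPure Φ) * PureBraid.addRight (toPure Φ) *
    (PureBraid.double 0 (toPure Φ))⁻¹ * (PureBraid.double 2 (toPure Φ))⁻¹

end PaB

/-- `ℤ⟨⟨X_0, …, X_{r-1}⟩⟩`: noncommutative formal power series, given by their coefficients on
words. -/
def NCSeries (r : ℕ) : Type := List (Fin r) → ℤ

namespace NCSeries

variable {r : ℕ}

instance : AddCommGroup (NCSeries r) := inferInstanceAs (AddCommGroup (List (Fin r) → ℤ))

@[ext] theorem ext {f g : NCSeries r} (h : ∀ w, f w = g w) : f = g := funext h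

/-- The product: sum over all ways to cut a word in two. -/
instance : Mul (NCSeries r) :=
  ⟨fun f g w => ∑ i ∈ Finset.range (w.length + 1), f (w.take i) * g (w.drop i)⟩

instance : One (NCSeries r) := ⟨fun w => if w = [] then 1 else 0⟩

theorem mul_apply (f g : NCSeries r) (w : List (Fin r)) :
    (f * g) w = ∑ i ∈ Finset.range (w.length + 1), f (w.take i) * g (w.drop i) := rfl

theorem one_apply (w : List (Fin r)) : (1 : NCSeries r) w = if w = [] then 1 else 0 := rfl

theorem add_apply (f g : NCSeries r) (w : List (Fin r)) : (f + g) w = f w + g w := rfl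

theorem zero_apply (w : List (Fin r)) : (0 : NCSeries r) w = 0 := rfl

/-- The series of the coefficients of the words that start with `a`, with `a` removed. -/
def shift (a : Fin r) (f : NCSeries r) : NCSeries r := fun w => f (a :: w)

theorem mul_nil (f g : NCSeries r) : (f * g) [] = f [] * g [] := by
  simp [mul_apply]

theorem mul_cons (f g : NCSeries r) (a : Fin r) (w : List (Fin r)) :
    (f * g) (a :: w) = f [] * g (a :: w) + (shift a f * g) w := by
  rw [mul_apply, List.length_cons, Finset.sum_range_succ', mul_apply, add_comm]
  rfl

protected theorem add_mul (f g h : NCSeries r) : (f + g) * h = f * h + g * h := by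
  ext w; simp [mul_apply, add_apply, add_mul, Finset.sum_add_distrib]

protected theorem mul_add (f g h : NCSeries r) : f * (g + h) = f * g + f * h := by
  ext w; simp [mul_apply, add_apply, mul_add, Finset.sum_add_distrib]

/-- Multiplication of all the coefficients by a constant. -/
def scale (c : ℤ) (f : NCSeries r) : NCSeries r := fun w => c * f w

theorem scale_mul (c : ℤ) (f g : NCSeries r) (w : List (Fin r)) :
    (scale c f * g) w = c * (f * g) w := by
  simp [mul_apply, scale, Finset.mul_sum, mul_assoc]

protected theorem mul_assoc (f g h : NCSeries r) : f * g * h = f * (g * h) := by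
  ext w
  induction w generalizing f with
  | nil => simp [mul_nil, mul_assoc]
  | cons a w ih =>
    have hs : shift a (f * g) = scale (f []) (shift a g) + shift a f * g := by
      ext v; exact mul_cons f g a v
    rw [mul_cons, mul_cons, hs, NCSeries.add_mul, add_apply, scale_mul, ih, mul_nil, mul_cons]
    ring

protected theorem one_mul (f : NCSeries r) : 1 * f = f := by
  ext w
  cases w with
  | nil => simp [mul_nil, one_apply]
  | cons a w =>
    have hs : shift a (1 : NCSeries r) = 0 := by ext v; simp [shift, one_apply, zero_apply]
    rw [mul_cons, hs]
    simp [one_apply, mul_apply, zero_apply]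

protected theorem mul_one (f : NCSeries r) : f * 1 = f := by
  ext w
  induction w generalizing f with
  | nil => simp [mul_nil, one_apply]
  | cons a w ih => rw [mul_cons, ih]; simp [one_apply, shift]

instance : Ring (NCSeries r) :=
  { (inferInstance : AddCommGroup (NCSeries r)) with
    mul := (· * ·)
    one := 1
    mul_assoc := NCSeries.mul_assoc
    one_mul := NCSeries.one_mul
    mul_one := NCSeries.mul_one
    left_distrib := NCSeries.mul_add
    right_distrib := NCSeries.add_mul
    zero_mul := fun f => by ext w; simp [mul_apply, zero_apply]
    mul_zero := fun f => by ext w; simp [mul_apply, zero_apply] }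

/-- The variable `X_i`. -/
def X (i : Fin r) : NCSeries r := fun w => if w = [i] then 1 else 0

/-- The series `∑ (-1)^n X_i^n`. -/
def geom (i : Fin r) : NCSeries r :=
  fun w => if ∀ a ∈ w, a = i then (-1) ^ w.length else 0

theorem X_mul_cons (i a : Fin r) (f : NCSeries r) (w : List (Fin r)) :
    (X i * f) (a :: w) = if a = i then f w else 0 := by
  rw [mul_cons]
  have hs : shift a (X i) = if a = i then 1 else 0 := by
    ext v
    by_cases h : a = i <;> simp [shift, X, h, one_apply, zero_apply]
  rw [hs]
  split_ifs <;> simp [X, zero_apply]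

theorem one_add_X_mul_geom (i : Fin r) : (1 + X i) * geom i = 1 := by
  rw [add_mul, one_mul]
  ext w
  cases w with
  | nil => simp [add_apply, mul_nil, X, geom, one_apply]
  | cons a w =>
    rw [add_apply, X_mul_cons]
    by_cases h : a = i
    · by_cases h' : ∀ b ∈ w, b = i
      · simp [geom, h, if_pos h', one_apply, pow_succ]
      · simp [geom, h, if_neg h', one_apply]
    · simp [geom, h, one_apply]

theorem geom_mul_one_add_X (i : Fin r) : geom i * (1 + X i) = 1 := by
  ext w
  induction w with
  | nil => simp [add_apply, mul_nil, X, geom, one_apply]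
  | cons a w ih =>
    rw [mul_cons]
    have hs : shift a (geom i) = if a = i then - geom i else 0 := by
      ext v
      by_cases h : a = i
      · subst h
        by_cases h' : ∀ b ∈ v, b = a
        · simp only [shift, geom, if_true]
          change _ = - (if _ then _ else _ : ℤ)
          rw [if_pos h', if_pos (by simpa using h'), List.length_cons, pow_succ]
          ring
        · simp only [shift, geom, if_true]
          change _ = - (if _ then _ else _ : ℤ)
          rw [if_neg h', if_neg (by simpa using h'), neg_zero]
      · simp [shift, geom, h, zero_apply]
    rw [hs]
    by_cases h : a = i
    · have : (-geom i * (1 + X i)) w = - (geom i * (1 + X i)) w := by rw [neg_mul]; rfl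
      rw [if_pos h, this, ih]
      by_cases hw : w = [] <;> simp [h, hw, geom, add_apply, X, one_apply]
    · rw [if_neg h, zero_mul]
      simp [h, geom, add_apply, X, one_apply, zero_apply]

/-- The Magnus expansion `x_i ↦ 1 + X_i`, as a homomorphism from the free group to the units of
the ring of noncommutative power series. -/
def magnus (r : ℕ) : FreeGroup (Fin r) →* (NCSeries r)ˣ :=
  FreeGroup.lift fun i => ⟨1 + X i, geom i, one_add_X_mul_geom i, geom_mul_one_add_X i⟩

/-- The homogeneous component of degree `k`. -/
def component (k : ℕ) (f : NCSeries r) : NCSeries r := fun w => if w.length = k then f w else 0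

/-- `f.StartsWith k φ`: the series `f` starts in degree `k` with the term `φ`, that is, its
homogeneous components of degree less than `k` vanish and the one of degree `k` is `φ ≠ 0`. -/
def StartsWith (f : NCSeries r) (k : ℕ) (φ : NCSeries r) : Prop :=
  (∀ i < k, component i f = 0) ∧ φ = component k f ∧ φ ≠ 0

/-- The projection `pr i` that sends `X_i` to `0` and renumbers the other variables in order:
the coefficient of a word in the image is that of the corresponding word without `X_i`. -/
def prFun (i : Fin (r + 1)) (f : NCSeries (r + 1)) : NCSeries r := fun w => f (w.map i.succAbove)

/-- `prFun i` as a ring homomorphism. -/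
def pr (i : Fin (r + 1)) : NCSeries (r + 1) →+* NCSeries r where
  toFun := prFun i
  map_one' := by ext w; simp [prFun, one_apply]
  map_mul' f g := by ext w; simp [prFun, mul_apply, List.map_take, List.map_drop]
  map_zero' := rfl
  map_add' _ _ := rfl

theorem pr_X_self (i : Fin (r + 1)) : pr i (X i) = 0 := by
  ext w
  change (if w.map i.succAbove = [i] then (1 : ℤ) else 0) = 0
  rw [if_neg]
  intro h
  obtain ⟨a, ha⟩ : ∃ a, i.succAbove a = i := by
    have : i ∈ w.map i.succAbove := by rw [h]; simp
    obtain ⟨a, -, ha⟩ := List.mem_map.1 this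
    exact ⟨a, ha⟩
  exact Fin.succAbove_ne i a ha

theorem pr_X_succAbove (i : Fin (r + 1)) (j : Fin r) : pr i (X (i.succAbove j)) = X j := by
  ext w
  change (if w.map i.succAbove = [i.succAbove j] then (1 : ℤ) else 0) = if w = [j] then 1 else 0
  have : w.map i.succAbove = [i.succAbove j] ↔ w = [j] := by
    rw [← List.map_singleton, (List.map_injective_iff.2 Fin.succAbove_right_injective).eq_iff]
  simp [this]

end NCSeries

/-! The homomorphism `ofFree 3` identifies the free group on three letters with F_3
(`ofFree_injective`, `freeKernel_three`), and Magnus' theorem (`magnusSubgroup_eq_LC`) says that Γ_k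
of a free group consists of the elements whose expansion is 1 up to degree k. So lying in Γ_k but
not in Γ_{k+1} means that the expansion minus 1 starts exactly in degree k, and only the Brunnian
condition remains.

On F_3, deleting a strand i among the first three is the map `forget i` of free groups
(`delete_ofFree`), which the Magnus expansion turns into `pr i` (`magnus_forget`). If the deletion
of Pent(Φ) is trivial, then `pr i` sends the whole expansion to 1 and kills its leading term.
Conversely, the leading term alone does not control the deleted braid of a general element of F_3;
here the shape of Pent(Φ) is used. Without strand i, the pentagon is a product of Φ, Φ⁻¹ and braids
obtained by adding or doubling a strand in two-strand braids, themselves deletions of Φ. These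
two-strand braids are detected by linking numbers, hence by linear Magnus coefficients, which vanish
both for k = 1 (by the condition on the leading term) and for k > 1. Once they are trivial, Φ
cancels against Φ⁻¹ (`delete_pent_eq_one`).

Magnus' theorem is proved with the Lyndon basis: the standard bracketings of Lyndon words span Γ_k
modulo Γ_{k+1} (`LC_le_hallSpan_top`), and the corresponding ring brackets are independent because
each has its Lyndon word as least word, with coefficient 1 (`ringBracket_apply_of_lt`). Freeness of
F_3 comes from a Hurwitz action with an extra component that records the word traced by the last
strand. Generation of F_3 by the A_{j4} comes from a Schreier argument in B_4. -/

open scoped commutatorElement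

/-! ### Lexicographic order on words -/

theorem List.lt_append_cases {α : Type*} [LinearOrder α] {u v : List α} (h : u < v) :
    (∃ v', v' ≠ [] ∧ v = u ++ v') ∨ ∀ w w', u ++ w < v ++ w' := by
  induction h with
  | nil => exact Or.inl ⟨_, by simp, rfl⟩
  | rel h => exact Or.inr fun w w' => List.Lex.rel h
  | cons h ih =>
    rcases ih with ⟨v', h1, h2⟩ | ih
    · exact Or.inl ⟨v', h1, by rw [h2]; rfl⟩
    · exact Or.inr fun w w' => List.Lex.cons (ih w w')

theorem List.append_lt_append_of_length_eq {α : Type*} [LinearOrder α] {u v : List α}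
    (h : u < v) (hl : u.length = v.length) (w w' : List α) : u ++ w < v ++ w' := by
  rcases List.lt_append_cases h with ⟨v', h1, h2⟩ | h'
  · have := congrArg List.length h2
    rw [List.length_append, hl] at this
    exact absurd (List.length_eq_zero_iff.1 (by omega)) h1
  · exact h' w w'

theorem List.le_append_right' {α : Type*} [LinearOrder α] (u v : List α) : u ≤ u ++ v := by
  cases v with
  | nil => simp
  | cons a v =>
    refine le_of_lt ?_
    conv_lhs => rw [← List.append_nil u]
    exact List.append_left_lt List.Lex.nil

/-! ### Standard bracketings of Lyndon words -/

/-- Binary trees with leaves labelled by `α`, i.e. iterated brackets of letters. -/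
inductive BracketTree (α : Type) : Type
  | leaf (a : α) : BracketTree α
  | node (s t : BracketTree α) : BracketTree α

namespace BracketTree

variable {α : Type}

/-- The word of the leaves from left to right. -/
def word : BracketTree α → List α
  | leaf a => [a]
  | node s t => s.word ++ t.word

theorem word_ne_nil (t : BracketTree α) : t.word ≠ [] := by
  induction t with
  | leaf a => simp [word]
  | node s t hs _ => simp [word, hs]

/-- The number of leaves. -/
def size (t : BracketTree α) : ℕ := t.word.length

theorem size_pos (t : BracketTree α) : 1 ≤ t.size :=
  List.length_pos_iff.2 t.word_ne_nil

theorem size_node (s t : BracketTree α) : (node s t).size = s.size + t.size := by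
  simp [size, word]

variable [LinearOrder α]

/-- `t.RightGE v`: the tree is a leaf, or the word of its right subtree is at least `v`. -/
def RightGE : BracketTree α → List α → Prop
  | leaf _, _ => True
  | node _ t, v => v ≤ t.word

/-- The trees of the Lyndon basis (standard bracketings of Lyndon words). -/
def Hall : BracketTree α → Prop
  | leaf _ => True
  | node s t => s.Hall ∧ t.Hall ∧ s.word < t.word ∧ s.RightGE t.word

/-- The word of a Hall tree is Lyndon, and its right factor is its least proper suffix. The two
facts are proved together: a suffix that starts inside the left factor is compared, through
`RightGE`, with the right factor of that left factor. -/
theorem Hall.suffix {t : BracketTree α} (ht : t.Hall) :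
    (∀ p q, p ≠ [] → q ≠ [] → t.word = p ++ q → t.word < q) ∧
    (∀ s₁ s₂, t = node s₁ s₂ → ∀ p q, p ≠ [] → q ≠ [] → t.word = p ++ q → s₂.word ≤ q) := by
  induction t with
  | leaf a =>
    refine ⟨fun p q hp hq h => ?_, fun _ _ h => by cases h⟩
    have := congrArg List.length h
    have h1 := List.length_pos_iff.2 hp
    have h2 := List.length_pos_iff.2 hq
    simp [word] at this
    omega
  | node s t ihs iht =>
    obtain ⟨hs, ht, hlt, hge⟩ := ht
    have hmin : ∀ p q, p ≠ [] → q ≠ [] → (node s t).word = p ++ q → t.word ≤ q := by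
      intro p q hp hq h
      rcases List.append_eq_append_iff.1 h with ⟨c, h1, h2⟩ | ⟨c, h1, h2⟩
      · rcases eq_or_ne c [] with rfl | hc
        · exact (by simpa using h2 : t.word = q).le
        · exact ((iht ht).1 c q hc hq h2).le
      · rcases eq_or_ne c [] with rfl | hc
        · exact (by simpa using h2.symm : t.word = q).le
        · rw [h2]
          cases s with
          | leaf a =>
            exfalso
            have := congrArg List.length h1
            have h1 := List.length_pos_iff.2 hp
            have h2 := List.length_pos_iff.2 hc
            simp [word] at this
            omega
          | node x y =>
            exact (le_trans hge ((ihs hs).2 x y rfl p c hp hc h1)).trans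
              (List.le_append_right' _ _)
    -- If the words of s and t differ at some letter, appending changes nothing. Otherwise the word
    -- of s is a prefix of that of t, and the Lyndon property of t makes its word smaller than the
    -- remaining suffix.
    have hB : (node s t).word < t.word := by
      rcases List.lt_append_cases hlt with ⟨v', h1, h2⟩ | h'
      · have := (iht ht).1 _ _ s.word_ne_nil h1 h2
        calc s.word ++ t.word < s.word ++ v' := List.append_left_lt this
          _ = t.word := h2.symm
      · simpa [word] using h' t.word []
    refine ⟨fun p q hp hq h => hB.trans_le (hmin p q hp hq h), ?_⟩
    rintro _ _ ⟨rfl, rfl⟩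
    exact hmin

theorem Hall.word_lt_right {s t : BracketTree α} (h : (node s t).Hall) :
    (node s t).word < t.word :=
  h.suffix.1 _ _ s.word_ne_nil t.word_ne_nil rfl

theorem Hall.word_lt_swap {s t : BracketTree α} (h : (node s t).Hall) :
    s.word ++ t.word < t.word ++ s.word :=
  h.word_lt_right.trans_le (List.le_append_right' _ _)

/-- A Lyndon word determines its standard bracketing: both right factors are the least proper suffix
of the same word, so they coincide and the induction continues on both sides. -/
theorem Hall.eq_of_word_eq {s t : BracketTree α} (hs : s.Hall) (ht : t.Hall)
    (h : s.word = t.word) : s = t := by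
  induction s generalizing t with
  | leaf a =>
    cases t with
    | leaf b => simpa [word] using h
    | node x y =>
      have := congrArg List.length h
      have h1 := x.size_pos
      have h2 := y.size_pos
      simp [word, size] at this h1 h2
      omega
  | node s₁ s₂ ih₁ ih₂ =>
    cases t with
    | leaf b =>
      have := congrArg List.length h
      have h1 := s₁.size_pos
      have h2 := s₂.size_pos
      simp [word, size] at this h1 h2
      omega
    | node x y =>
      have e : s₂.word = y.word := le_antisymm
        (hs.suffix.2 _ _ rfl _ _ x.word_ne_nil y.word_ne_nil h)
        (ht.suffix.2 _ _ rfl _ _ s₁.word_ne_nil s₂.word_ne_nil h.symm)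
      have e' : s₁.word = x.word := by
        simp only [word] at h
        rw [e] at h
        exact List.append_cancel_right h
      rw [ih₁ hs.1 ht.1 e', ih₂ hs.2.1 ht.2.1 e]

/-- The bracket in a group. -/
def groupBracket {G : Type} [Group G] (f : α → G) : BracketTree α → G
  | leaf a => f a
  | node s t => ⁅s.groupBracket f, t.groupBracket f⁆

/-- The bracket in an associative ring. -/
def ringBracket {R : Type} [Ring R] (f : α → R) : BracketTree α → R
  | leaf a => f a
  | node s t => s.ringBracket f * t.ringBracket f - t.ringBracket f * s.ringBracket f

end BracketTree

/-! ### Commutator calculus in the lower central series -/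

namespace PureBraid

variable {G : Type} [Group G]

theorem Γ_succ {k : ℕ} (hk : 1 ≤ k) (S : Subgroup G) : Γ (k + 1) S = ⁅Γ k S, S⁆ := by
  obtain ⟨j, rfl⟩ := Nat.exists_eq_add_of_le' hk
  rfl

theorem Γ_antitone (S : Subgroup G) : Antitone fun k => Γ k S :=
  fun _ _ h => S.lowerCentralSeries_antitone (Nat.sub_le_sub_right h 1)

theorem Γ_map {H : Type} [Group H] (f : G →* H) (k : ℕ) (S : Subgroup G) :
    (Γ k S).map f = Γ k (S.map f) := Subgroup.map_lowerCentralSeries _ _ _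

/-- The lower central series of a group, starting with `Γ_1 = G`. -/
abbrev LC (G : Type) [Group G] (k : ℕ) : Subgroup G := Γ k (⊤ : Subgroup G)

instance LC_normal (k : ℕ) : (LC G k).Normal := by
  unfold LC Γ; infer_instance

theorem LC_one : LC G 1 = ⊤ := rfl

/-- The three subgroups lemma modulo a normal subgroup, obtained by passing to the quotient. -/
theorem commutator_le_of_rotate {A B C N : Subgroup G} [N.Normal] (h1 : ⁅⁅B, C⁆, A⁆ ≤ N)
    (h2 : ⁅⁅C, A⁆, B⁆ ≤ N) : ⁅⁅A, B⁆, C⁆ ≤ N := by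
  have key : ∀ K : Subgroup G, K ≤ N ↔ K.map (QuotientGroup.mk' N) = ⊥ := by
    intro K
    rw [Subgroup.map_eq_bot_iff, QuotientGroup.ker_mk']
  rw [key, Subgroup.map_commutator, Subgroup.map_commutator] at *
  exact Subgroup.commutator_commutator_eq_bot_of_rotate h1 h2

/-- Induction on j with the three subgroups lemma applied to Γ_j, the whole group and Γ_i. An index
0 gives the whole group again, as index 1 does, so those cases need only normality. -/
theorem LC_commutator_le {i j : ℕ} : ⁅LC G i, LC G j⁆ ≤ LC G (i + j) := by
  induction j generalizing i with
  | zero => exact Subgroup.commutator_le_left _ _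
  | succ j ih =>
    rcases Nat.eq_zero_or_pos i with rfl | hi
    · rw [zero_add]; exact Subgroup.commutator_le_right _ _
    rcases Nat.eq_zero_or_pos j with rfl | hj
    · exact (Γ_succ hi _).ge
    · have e : LC G (j + 1) = ⁅LC G j, ⊤⁆ := Γ_succ hj _
      rw [e, Subgroup.commutator_comm]
      apply commutator_le_of_rotate
      · rw [Subgroup.commutator_comm ⊤]
        have : ⁅LC G i, (⊤ : Subgroup G)⁆ = LC G (i + 1) := (Γ_succ hi _).symm
        rw [this]
        exact ih.trans (by rw [add_right_comm]; rfl)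
      · have : ⁅LC G (i + j), (⊤ : Subgroup G)⁆ = LC G (i + (j + 1)) :=
          (Γ_succ (by omega) _).symm
        rw [← this]
        exact Subgroup.commutator_mono ih le_rfl

theorem commutator_mem_LC {i j n : ℕ} {a b : G} (ha : a ∈ LC G i) (hb : b ∈ LC G j)
    (hn : n ≤ i + j) : ⁅a, b⁆ ∈ LC G n :=
  Γ_antitone _ hn (LC_commutator_le (Subgroup.commutator_mem_commutator ha hb))

theorem groupBracket_mem_LC {α : Type} (f : α → G) (t : BracketTree α) :
    t.groupBracket f ∈ LC G t.size := by
  induction t with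
  | leaf a => exact Subgroup.mem_top _
  | node s t hs ht => exact commutator_mem_LC hs ht (BracketTree.size_node s t).le

/-- Conjugation acts trivially on Γ_n modulo Γ_{n+1}, so T, though not assumed normal, is stable
under conjugation of its elements in Γ_n. -/
theorem conj_mem_of_LC {n : ℕ} (hn : 1 ≤ n) {T : Subgroup G} (hT : LC G (n + 1) ≤ T) {g x : G}
    (hg : g ∈ LC G n) (h : g ∈ T) : x * g * x⁻¹ ∈ T := by
  have : x * g * x⁻¹ = ⁅x, g⁆ * g := by rw [commutatorElement_def]; group
  rw [this]
  exact T.mul_mem (hT (commutator_mem_LC (i := 1) (Subgroup.mem_top x) hg (by omega))) h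

/-- The Jacobi identity modulo the lower central series. -/
theorem jacobi_mem {i j l n : ℕ} (hi : 1 ≤ i) (hj : 1 ≤ j) (hl : 1 ≤ l) (hn : n = i + j + l)
    {T : Subgroup G} (hT : LC G (n + 1) ≤ T) {a b c : G} (ha : a ∈ LC G i) (hb : b ∈ LC G j)
    (hc : c ∈ LC G l) (h1 : ⁅⁅b, c⁆, a⁆ ∈ T) (h2 : ⁅⁅c, a⁆, b⁆ ∈ T) : ⁅⁅a, b⁆, c⁆ ∈ T := by
  -- The Hall–Witt identity contains conjugated entries. Replacing such an entry by the unconjugated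
  -- one changes the commutator only by terms of weight above n and by a conjugation, neither of
  -- which affects membership in T.
  have main : ∀ {p q s : ℕ} {u x y : G}, 1 ≤ s → p + q = n → u ∈ LC G p → x ∈ LC G q →
      y ∈ LC G s → (⁅u, y * x * y⁻¹⁆ ∈ T ↔ ⁅u, x⁆ ∈ T) := by
    intro p q s u x y hs hpq hu hx hy
    have e : ⁅u, y * x * y⁻¹⁆ = ⁅u, ⁅y, x⁆⁆ * (⁅y, x⁆ * ⁅u, x⁆ * ⁅y, x⁆⁻¹) := by
      simp only [commutatorElement_def]; group
    have m1 : ⁅u, ⁅y, x⁆⁆ ∈ T :=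
      hT (commutator_mem_LC hu (commutator_mem_LC hy hx le_rfl) (by omega))
    have m2 : ⁅u, x⁆ ∈ LC G n := commutator_mem_LC hu hx hpq.ge
    rw [e, T.mul_mem_cancel_left m1]
    refine ⟨fun h => ?_, fun h => conj_mem_of_LC (by omega) hT m2 h⟩
    have := conj_mem_of_LC (x := ⁅y, x⁆⁻¹) (by omega) hT ((LC_normal n).conj_mem _ m2 _) h
    rwa [show ⁅y, x⁆⁻¹ * (⁅y, x⁆ * ⁅u, x⁆ * ⁅y, x⁆⁻¹) * ⁅y, x⁆⁻¹⁻¹ = ⁅u, x⁆ by group] at this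
  have hw := commutatorElement_commutatorElement_conj_mul a b c
  have k1 := (main hl (by omega) (commutator_mem_LC hb hc le_rfl) ha hc).2 h1
  have k2 := (main hi (by omega) (commutator_mem_LC hc ha le_rfl) hb ha).2 h2
  refine (main hj (by omega) (commutator_mem_LC ha hb le_rfl) hc hb).1 ?_
  rw [mul_assoc] at hw
  rw [eq_inv_of_mul_eq_one_left hw]
  exact T.inv_mem (T.mul_mem k1 k2)

variable {α : Type} [LinearOrder α]

/-- The subgroup generated modulo `Γ_{n+1}` by the Hall brackets of size `n` whose word
satisfies `p`. -/
def hallSpan (f : α → G) (n : ℕ) (p : List α → Prop) : Subgroup G :=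
  Subgroup.closure ({g | ∃ t : BracketTree α, t.Hall ∧ t.size = n ∧ p t.word ∧
    g = t.groupBracket f} ∪ (LC G (n + 1) : Set G))

theorem LC_le_hallSpan (f : α → G) (n : ℕ) (p : List α → Prop) :
    LC G (n + 1) ≤ hallSpan f n p :=
  fun _ h => Subgroup.subset_closure (Or.inr h)

theorem groupBracket_mem_hallSpan (f : α → G) {n : ℕ} {p : List α → Prop} {t : BracketTree α}
    (ht : t.Hall) (hn : t.size = n) (hp : p t.word) : t.groupBracket f ∈ hallSpan f n p :=
  Subgroup.subset_closure (Or.inl ⟨t, ht, hn, hp, rfl⟩)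

theorem hallSpan_mono (f : α → G) (n : ℕ) {p q : List α → Prop} (h : ∀ w, p w → q w) :
    hallSpan f n p ≤ hallSpan f n q := by
  refine Subgroup.closure_mono (Set.union_subset_union_left _ ?_)
  rintro _ ⟨t, h1, h2, h3, rfl⟩
  exact ⟨t, h1, h2, h _ h3, rfl⟩

/-- A commutator of an element of `hallSpan` lies in `T` if it does so for the generators. -/
theorem commutator_mem_of_hallSpan (f : α → G) {i j n : ℕ} (hi : 1 ≤ i) (hj : 1 ≤ j)
    (hn : n = i + j) {p : List α → Prop} {T : Subgroup G} (hT : LC G (n + 1) ≤ T) {a b : G}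
    (hb : b ∈ LC G j) (ha : a ∈ hallSpan f i p)
    (H : ∀ t : BracketTree α, t.Hall → t.size = i → p t.word → ⁅t.groupBracket f, b⁆ ∈ T) :
    ⁅a, b⁆ ∈ T := by
  -- Membership in Γ_i is carried through the induction because expanding a commutator of a product
  -- or an inverse produces conjugates that are harmless only for elements of Γ_n.
  suffices a ∈ LC G i ∧ ⁅a, b⁆ ∈ T from this.2
  refine Subgroup.closure_induction (p := fun a _ => a ∈ LC G i ∧ ⁅a, b⁆ ∈ T)
    ?_ ?_ ?_ ?_ ha
  · rintro _ (⟨t, h1, h2, h3, rfl⟩ | h)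
    · exact ⟨h2 ▸ groupBracket_mem_LC f t, H t h1 h2 h3⟩
    · exact ⟨Γ_antitone _ (Nat.le_succ i) h, hT (commutator_mem_LC h hb (by omega))⟩
  · exact ⟨one_mem _, by rw [commutatorElement_one_left]; exact one_mem _⟩
  · rintro x y _ _ ⟨hx, hx'⟩ ⟨hy, hy'⟩
    refine ⟨mul_mem hx hy, ?_⟩
    rw [commutatorElement_mul_left_eq_conj_mul]
    exact mul_mem (conj_mem_of_LC (by omega) hT (commutator_mem_LC hy hb hn.le) hy') hx'
  · rintro x _ ⟨hx, hx'⟩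
    refine ⟨inv_mem hx, ?_⟩
    rw [commutatorElement_inv_left, ← commutatorElement_inv]
    simpa using conj_mem_of_LC (x := x⁻¹) (by omega) hT
      (inv_mem (commutator_mem_LC hx hb hn.le)) (inv_mem hx')

end PureBraid

/-! ### Rewriting commutators into Hall brackets -/

namespace PureBraid

variable {G : Type} [Group G] {α : Type} [LinearOrder α]

open BracketTree

/-- Removes the requirement that the first word be the smaller one: equal words give equal trees and
a trivial commutator, and exchanging the entries inverts the commutator. -/
theorem commutator_groupBracket_mem_of_lt (f : α → G) {n : ℕ} {m : List α}
    (ih : ∀ m' < m, ∀ s t : BracketTree α, s.Hall → t.Hall → s.size + t.size = n →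
      s.word < t.word → t.word = m' → ⁅s.groupBracket f, t.groupBracket f⁆ ∈
        hallSpan f n (· < m'))
    {s t : BracketTree α} (hs : s.Hall) (ht : t.Hall) (hn : s.size + t.size = n)
    (hsm : s.word < m) (htm : t.word < m) :
    ⁅s.groupBracket f, t.groupBracket f⁆ ∈ hallSpan f n (· < m) := by
  rcases lt_trichotomy s.word t.word with h | h | h
  · exact hallSpan_mono f n (fun w hw => hw.trans htm) (ih _ htm s t hs ht hn h rfl)
  · rw [hs.eq_of_word_eq ht h, commutatorElement_self]
    exact one_mem _
  · rw [← commutatorElement_inv]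
    exact inv_mem (hallSpan_mono f n (fun w hw => hw.trans hsm)
      (ih _ hsm t s ht hs (by omega) h rfl))

/-- Double induction, on the total size and then on the larger word m. If s and t do not form a Hall
tree, then s = (x, y) with y < t, and the Jacobi identity trades [[x, y], t] for [[y, t], x] and
[[t, x], y]. The bound on the words in the span is what makes the inner induction go down. -/
theorem commutator_groupBracket_mem_aux [Finite α] (f : α → G) (n : ℕ) :
    ∀ m : List α, ∀ s t : BracketTree α, s.Hall → t.Hall → s.size + t.size = n →
      s.word < t.word → t.word = m → ⁅s.groupBracket f, t.groupBracket f⁆ ∈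
        hallSpan f n (· < m) := by
  induction n using Nat.strong_induction_on with
  | _ n ihn =>
  intro m s t hs ht hn hlt hm
  -- The lexicographic order is not well-founded on all words in general; it is on the finite set of
  -- words of length at most n.
  have hfin : {w : List α | w.length ≤ n}.Finite := List.finite_length_le α n
  have hwf : {w : List α | w.length ≤ n}.WellFoundedOn (· < ·) :=
    hfin.wellFoundedOn
  have hmem : m ∈ {w : List α | w.length ≤ n} := by
    change m.length ≤ n
    rw [← hm]; unfold size at hn; omega
  revert s t
  refine hwf.induction (P := fun m => ∀ s t : BracketTree α, s.Hall → t.Hall →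
    s.size + t.size = n → s.word < t.word → t.word = m →
      ⁅s.groupBracket f, t.groupBracket f⁆ ∈ hallSpan f n (· < m)) hmem ?_
  intro m hmem ihm s t hs ht hn hlt hm
  replace ihm : ∀ m' < m, ∀ s t : BracketTree α, s.Hall → t.Hall → s.size + t.size = n →
      s.word < t.word → t.word = m' → ⁅s.groupBracket f, t.groupBracket f⁆ ∈
        hallSpan f n (· < m') := by
    intro m' hm' s t hs ht hn hlt hm
    refine ihm m' ?_ hm' s t hs ht hn hlt hm
    change m'.length ≤ n
    rw [← hm]; unfold size at hn; omega
  have hgen := fun {s t : BracketTree α} => commutator_groupBracket_mem_of_lt f ihm (s := s) (t := t)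
  subst hm
  by_cases hge : s.RightGE t.word
  · have hst : (node s t).Hall := ⟨hs, ht, hlt, hge⟩
    exact groupBracket_mem_hallSpan f (p := (· < t.word)) (t := node s t) hst
      ((size_node s t).trans hn) hst.word_lt_right
  · cases s with
    | leaf a => exact absurd trivial hge
    | node x y =>
      have hyt : y.word < t.word := not_le.1 hge
      have hx := hs.1
      have hy := hs.2.1
      have hxy : x.word < y.word := hs.2.2.1
      have hxt := hxy.trans hyt
      rw [size_node] at hn
      have px := x.size_pos
      have py := y.size_pos
      have pt := t.size_pos
      -- Each inner commutator has smaller total size, so it expands into Hall brackets with words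
      -- below that of t. The remaining entry x or y is also below t, so `hgen` handles the outer
      -- commutator.
      refine jacobi_mem (T := hallSpan f n (· < t.word)) px py pt hn.symm (LC_le_hallSpan _ _ _)
        (groupBracket_mem_LC f x) (groupBracket_mem_LC f y) (groupBracket_mem_LC f t) ?_ ?_
      · refine commutator_mem_of_hallSpan f (p := (· < t.word)) (i := y.size + t.size) (j := x.size) (by omega) px
          (by omega) (LC_le_hallSpan _ _ _) (groupBracket_mem_LC f x)
          (ihn (y.size + t.size) (by omega) t.word y t hy ht rfl hyt rfl) ?_
        intro c hc hcn hct
        exact hgen hc hx (by omega) hct hxt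
      · rw [← commutatorElement_inv (x.groupBracket f)]
        refine commutator_mem_of_hallSpan f (p := (· < t.word)) (i := x.size + t.size) (j := y.size) (by omega) py
          (by omega) (LC_le_hallSpan _ _ _) (groupBracket_mem_LC f y)
          (inv_mem (ihn (x.size + t.size) (by omega) t.word x t hx ht rfl hxt rfl)) ?_
        intro c hc hcn hct
        exact hgen hc hy (by omega) hct hyt

/-- The commutator of two Hall brackets is a product of Hall brackets, up to longer ones. -/
theorem commutator_groupBracket_mem [Finite α] (f : α → G) {s t : BracketTree α} (hs : s.Hall)
    (ht : t.Hall) : ⁅s.groupBracket f, t.groupBracket f⁆ ∈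
      hallSpan f (s.size + t.size) (fun _ => True) := by
  rcases lt_trichotomy s.word t.word with h | h | h
  · exact hallSpan_mono f _ (fun w _ => trivial)
      (commutator_groupBracket_mem_aux f _ _ s t hs ht rfl h rfl)
  · rw [hs.eq_of_word_eq ht h, commutatorElement_self]
    exact one_mem _
  · rw [← commutatorElement_inv, add_comm]
    exact inv_mem (hallSpan_mono f _ (fun w _ => trivial)
      (commutator_groupBracket_mem_aux f _ _ t s ht hs rfl h rfl))

/-- The lower central series of a group generated by `f` is spanned by Hall brackets. -/
theorem LC_le_hallSpan_top [Finite α] (f : α → G) (hf : Subgroup.closure (Set.range f) = ⊤)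
    {n : ℕ} (hn : 1 ≤ n) : LC G n ≤ hallSpan f n (fun _ => True) := by
  induction n, hn using Nat.le_induction with
  | base =>
    rw [LC_one, ← hf, Subgroup.closure_le]
    rintro _ ⟨a, rfl⟩
    exact groupBracket_mem_hallSpan f (t := leaf a) trivial rfl trivial
  | succ n hn ih =>
    have e : LC G (n + 1) = ⁅LC G n, ⊤⁆ := Γ_succ hn _
    rw [e, Subgroup.commutator_le]
    intro g hg b _
    refine commutator_mem_of_hallSpan f hn le_rfl rfl (LC_le_hallSpan _ _ _) (Subgroup.mem_top b)
      (ih hg) ?_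
    intro t ht htn _
    -- The commutator is inverted to bring the arbitrary element b to the left, where it can be
    -- expanded into letters as the bracket t was.
    rw [← commutatorElement_inv]
    refine inv_mem ?_
    have hb : b ∈ hallSpan f 1 (fun _ => True) := by
      have : b ∈ Subgroup.closure (Set.range f) := hf ▸ Subgroup.mem_top b
      refine (Subgroup.closure_le _).2 ?_ this
      rintro _ ⟨a, rfl⟩
      exact groupBracket_mem_hallSpan f (t := leaf a) trivial rfl trivial
    refine commutator_mem_of_hallSpan f le_rfl hn (add_comm n 1) (LC_le_hallSpan _ _ _)
      (htn ▸ groupBracket_mem_LC f t) hb ?_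
    intro s hs hsn _
    have := commutator_groupBracket_mem f hs ht
    rwa [hsn, htn, add_comm] at this

end PureBraid

/-! ### Lowest-degree terms of Magnus expansions -/

namespace NCSeries

variable {r : ℕ}

/-- All the coefficients in degrees less than `k` vanish. -/
def VanishBelow (k : ℕ) (f : NCSeries r) : Prop := ∀ w, w.length < k → f w = 0

theorem sub_apply (f g : NCSeries r) (w : List (Fin r)) : (f - g) w = f w - g w := rfl

theorem neg_apply (f : NCSeries r) (w : List (Fin r)) : (-f) w = -f w := rfl

theorem VanishBelow.mono {i j : ℕ} {f : NCSeries r} (hf : VanishBelow j f) (h : i ≤ j) :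
    VanishBelow i f := fun w hw => hf w (hw.trans_le h)

theorem VanishBelow.sub {k : ℕ} {f g : NCSeries r} (hf : VanishBelow k f)
    (hg : VanishBelow k g) : VanishBelow k (f - g) := fun w hw => by
  rw [sub_apply, hf w hw, hg w hw, sub_zero]

theorem VanishBelow.add {k : ℕ} {f g : NCSeries r} (hf : VanishBelow k f)
    (hg : VanishBelow k g) : VanishBelow k (f + g) := fun w hw => by
  rw [add_apply, hf w hw, hg w hw, add_zero]

theorem VanishBelow.neg {k : ℕ} {f : NCSeries r} (hf : VanishBelow k f) :
    VanishBelow k (-f) := fun w hw => by rw [neg_apply, hf w hw, neg_zero]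

theorem VanishBelow.mul {i j : ℕ} {f g : NCSeries r} (hf : VanishBelow i f)
    (hg : VanishBelow j g) : VanishBelow (i + j) (f * g) := fun w hw => by
  rw [mul_apply]
  refine Finset.sum_eq_zero fun l hl => ?_
  have hl' := Finset.mem_range.1 hl
  rcases lt_or_ge l i with h | h
  · rw [hf _ (by rw [List.length_take]; omega), zero_mul]
  · rw [hg _ (by rw [List.length_drop]; omega), mul_zero]

/-- In the lowest possible degree i + j only the cut of the word at position i contributes. -/
theorem VanishBelow.mul_apply {i j : ℕ} {f g : NCSeries r} (hf : VanishBelow i f)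
    (hg : VanishBelow j g) {w : List (Fin r)} (hw : w.length = i + j) :
    (f * g) w = f (w.take i) * g (w.drop i) := by
  rw [NCSeries.mul_apply, Finset.sum_eq_single i]
  · intro l hl hne
    have hl' := Finset.mem_range.1 hl
    rcases lt_or_gt_of_ne hne with h | h
    · rw [hf _ (by rw [List.length_take]; omega), zero_mul]
    · rw [hg _ (by rw [List.length_drop]; omega), mul_zero]
  · intro h
    exact absurd (Finset.mem_range.2 (by omega)) h

theorem VanishBelow.mul_unit_apply {k : ℕ} {f u : NCSeries r} (hf : VanishBelow k f)
    (hu : u [] = 1) {w : List (Fin r)} (hw : w.length = k) : (f * u) w = f w := by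
  have hu0 : VanishBelow 0 u := fun _ h => absurd h (Nat.not_lt_zero _)
  rw [hf.mul_apply hu0 (by omega), List.take_of_length_le hw.le, List.drop_of_length_le hw.le, hu,
    mul_one]

theorem magnus_apply_nil (g : FreeGroup (Fin r)) : (magnus r g : NCSeries r) [] = 1 := by
  induction g using FreeGroup.induction_on with
  | C1 => rfl
  | of i => simp [magnus, add_apply, one_apply, X]
  | inv_of i h =>
    simp [magnus, geom]
  | mul a b ha hb => rw [map_mul, Units.val_mul, mul_nil, ha, hb, one_mul]

theorem magnus_mul_sub_one (a b : FreeGroup (Fin r)) :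
    (magnus r (a * b) : NCSeries r) - 1 = ((magnus r a : NCSeries r) - 1) +
      ((magnus r b : NCSeries r) - 1) +
      ((magnus r a : NCSeries r) - 1) * ((magnus r b : NCSeries r) - 1) := by
  rw [map_mul, Units.val_mul]; noncomm_ring

theorem magnus_inv_sub_one (a : FreeGroup (Fin r)) :
    (magnus r a⁻¹ : NCSeries r) - 1 = -((magnus r a : NCSeries r) - 1) * magnus r a⁻¹ := by
  have : (magnus r a : NCSeries r) * (magnus r a⁻¹ : NCSeries r) = 1 := by
    rw [← Units.val_mul, ← map_mul, mul_inv_cancel, map_one, Units.val_one]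
  rw [neg_sub, sub_mul, this, one_mul]

/-- The factor on the right has constant term 1 and does not affect the lowest-degree part. Hence
group commutators become ring commutators on leading terms. -/
theorem magnus_commutator_sub_one (a b : FreeGroup (Fin r)) :
    (magnus r ⁅a, b⁆ : NCSeries r) - 1 =
      (((magnus r a : NCSeries r) - 1) * ((magnus r b : NCSeries r) - 1) -
        ((magnus r b : NCSeries r) - 1) * ((magnus r a : NCSeries r) - 1)) *
        magnus r (b * a)⁻¹ := by
  have h1 : (magnus r (b * a) : NCSeries r) * (magnus r (b * a)⁻¹ : NCSeries r) = 1 := by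
    rw [← Units.val_mul, ← map_mul, mul_inv_cancel, map_one, Units.val_one]
  have h2 : (magnus r ⁅a, b⁆ : NCSeries r) =
      magnus r a * magnus r b * magnus r (b * a)⁻¹ := by
    rw [← Units.val_mul, ← Units.val_mul, ← map_mul, ← map_mul, commutatorElement_def,
      mul_inv_rev, mul_assoc (a * b)]
  have h3 : ((magnus r a : NCSeries r) - 1) * ((magnus r b : NCSeries r) - 1) -
      ((magnus r b : NCSeries r) - 1) * ((magnus r a : NCSeries r) - 1) =
      magnus r a * magnus r b - magnus r (b * a) := by
    rw [map_mul, Units.val_mul]; noncomm_ring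
  rw [h2, h3, sub_mul, h1]

/-- The elements of the free group whose Magnus expansion is `1` up to terms of degree `k`. -/
def magnusSubgroup (r k : ℕ) : Subgroup (FreeGroup (Fin r)) where
  carrier := {g | VanishBelow k ((magnus r g : NCSeries r) - 1)}
  one_mem' := by
    intro w _
    simp [zero_apply]
  mul_mem' {a b} ha hb := by
    change VanishBelow _ _
    rw [magnus_mul_sub_one]
    exact (ha.add hb).add ((ha.mul hb).mono (Nat.le_add_right _ _))
  inv_mem' {a} ha := by
    change VanishBelow _ _
    rw [magnus_inv_sub_one]
    exact (ha.neg.mul (j := 0) (fun _ h => absurd h (Nat.not_lt_zero _)))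

theorem mem_magnusSubgroup {k : ℕ} {g : FreeGroup (Fin r)} :
    g ∈ magnusSubgroup r k ↔ VanishBelow k ((magnus r g : NCSeries r) - 1) := Iff.rfl

theorem mem_magnusSubgroup_one (g : FreeGroup (Fin r)) : g ∈ magnusSubgroup r 1 := by
  intro w hw
  rw [List.length_eq_zero_iff.1 (by omega : w.length = 0), sub_apply, magnus_apply_nil]
  rfl

theorem commutator_mem_magnusSubgroup {i j : ℕ} {a b : FreeGroup (Fin r)}
    (ha : a ∈ magnusSubgroup r i) (hb : b ∈ magnusSubgroup r j) :
    ⁅a, b⁆ ∈ magnusSubgroup r (i + j) := by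
  rw [mem_magnusSubgroup, magnus_commutator_sub_one]
  exact ((ha.mul hb).sub (by rw [add_comm]; exact hb.mul ha)).mul (j := 0)
    (fun _ h => absurd h (Nat.not_lt_zero _))

theorem magnus_commutator_apply {i j : ℕ} {a b : FreeGroup (Fin r)}
    (ha : a ∈ magnusSubgroup r i) (hb : b ∈ magnusSubgroup r j) {w : List (Fin r)}
    (hw : w.length = i + j) : ((magnus r ⁅a, b⁆ : NCSeries r) - 1) w =
      ((magnus r a : NCSeries r) - 1) (w.take i) * ((magnus r b : NCSeries r) - 1) (w.drop i) -
      ((magnus r b : NCSeries r) - 1) (w.take j) * ((magnus r a : NCSeries r) - 1) (w.drop j) := by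
  have hba := hb.mul ha
  rw [add_comm] at hba
  rw [magnus_commutator_sub_one, ((ha.mul hb).sub hba).mul_unit_apply (magnus_apply_nil _) hw,
    sub_apply, ha.mul_apply hb hw, hb.mul_apply ha (by omega)]

theorem magnus_mul_apply {k : ℕ} (hk : 1 ≤ k) {a b : FreeGroup (Fin r)}
    (ha : a ∈ magnusSubgroup r k) (hb : b ∈ magnusSubgroup r k) {w : List (Fin r)}
    (hw : w.length = k) : ((magnus r (a * b) : NCSeries r) - 1) w =
      ((magnus r a : NCSeries r) - 1) w + ((magnus r b : NCSeries r) - 1) w := by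
  rw [magnus_mul_sub_one, add_apply, add_apply, ha.mul hb w (by omega), add_zero]

theorem magnus_inv_apply {k : ℕ} {a : FreeGroup (Fin r)}
    (ha : a ∈ magnusSubgroup r k) {w : List (Fin r)}
    (hw : w.length = k) : ((magnus r a⁻¹ : NCSeries r) - 1) w =
      -((magnus r a : NCSeries r) - 1) w := by
  rw [magnus_inv_sub_one, ha.neg.mul_unit_apply (magnus_apply_nil _) hw, neg_apply]

theorem LC_le_magnusSubgroup {k : ℕ} (hk : 1 ≤ k) :
    PureBraid.LC (FreeGroup (Fin r)) k ≤ magnusSubgroup r k := by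
  induction k, hk using Nat.le_induction with
  | base => exact fun g _ => mem_magnusSubgroup_one g
  | succ k hk ih =>
    rw [PureBraid.LC, PureBraid.Γ_succ hk, Subgroup.commutator_le]
    exact fun a ha b _ => commutator_mem_magnusSubgroup (ih ha) (mem_magnusSubgroup_one b)

open BracketTree

theorem ringBracket_vanishBelow (t : BracketTree (Fin r)) :
    VanishBelow t.size (t.ringBracket X) := by
  induction t with
  | leaf a =>
    intro w hw
    rw [List.length_eq_zero_iff.1 (by simpa [size, word] using hw : w.length = 0)]
    simp [ringBracket, X]
  | node s t hs ht =>
    rw [size_node]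
    refine (hs.mul ht).sub ?_
    rw [add_comm]
    exact ht.mul hs

theorem ringBracket_node_apply (s t : BracketTree (Fin r)) {w : List (Fin r)}
    (hw : w.length = s.size + t.size) : (node s t).ringBracket X w =
      s.ringBracket X (w.take s.size) * t.ringBracket X (w.drop s.size) -
      t.ringBracket X (w.take t.size) * s.ringBracket X (w.drop t.size) := by
  rw [ringBracket, sub_apply, (ringBracket_vanishBelow s).mul_apply (ringBracket_vanishBelow t) hw,
    (ringBracket_vanishBelow t).mul_apply (ringBracket_vanishBelow s) (by omega)]

/-- The leading term of the Magnus expansion of a bracket is the bracket of the variables. -/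
theorem magnus_groupBracket_apply (t : BracketTree (Fin r)) {w : List (Fin r)}
    (hw : w.length = t.size) :
    ((magnus r (t.groupBracket FreeGroup.of) : NCSeries r) - 1) w = t.ringBracket X w := by
  have hD : ∀ t : BracketTree (Fin r), t.groupBracket FreeGroup.of ∈ magnusSubgroup r t.size :=
    fun t => LC_le_magnusSubgroup t.size_pos (PureBraid.groupBracket_mem_LC _ t)
  induction t generalizing w with
  | leaf a => simp [magnus, groupBracket, ringBracket]
  | node s t hs ht =>
    rw [size_node] at hw
    rw [groupBracket, magnus_commutator_apply (hD s) (hD t) hw, ringBracket_node_apply s t hw,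
      hs, hs, ht, ht] <;> simp <;> omega

/-- The leading word of a Hall bracket is the word of the tree. -/
theorem ringBracket_apply_of_lt {t : BracketTree (Fin r)} (ht : t.Hall) :
    t.ringBracket X t.word = 1 ∧
      ∀ w, w.length = t.size → w < t.word → t.ringBracket X w = 0 := by
  induction t with
  | leaf a =>
    refine ⟨by simp [ringBracket, X, word], fun w _ h => ?_⟩
    have : w ≠ [a] := h.ne
    simp [ringBracket, X, this]
  | node s t hs ht' =>
    have hswap := ht.word_lt_swap
    obtain ⟨hs1, hs2⟩ := hs ht.1
    obtain ⟨ht1, ht2⟩ := ht' ht.2.1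
    -- The subtracted product cannot interfere: its least word is that of t followed by that of s,
    -- which is larger than the word of the tree by `word_lt_swap`.
    have main : ∀ w, w.length = s.size + t.size → w < t.word ++ s.word →
        t.ringBracket X (w.take t.size) * s.ringBracket X (w.drop t.size) = 0 := by
      intro w hw hlt
      rcases lt_trichotomy (w.take t.size) t.word with h | h | h
      · rw [ht2 _ (by rw [List.length_take]; omega) h, zero_mul]
      · rcases lt_or_ge (w.drop t.size) s.word with h' | h'
        · rw [hs2 _ (by rw [List.length_drop]; omega) h', mul_zero]
        · exfalso
          rw [← List.take_append_drop t.size w, h] at hlt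
          rcases h'.eq_or_lt with h' | h'
          · rw [h'] at hlt; exact lt_irrefl _ hlt
          · exact lt_asymm hlt (List.append_left_lt h')
      · exfalso
        have := List.append_lt_append_of_length_eq h
          (by rw [List.length_take]; unfold size at *; omega) s.word (w.drop t.size)
        rw [List.take_append_drop] at this
        exact lt_asymm hlt this
    constructor
    · have hl : (node s t).word.length = s.size + t.size := size_node s t
      rw [ringBracket_node_apply s t hl, main _ hl hswap]
      simp only [word, size, List.take_left, List.drop_left, hs1, ht1]
      norm_num
    · intro w hw hlt
      rw [size_node] at hw
      rw [ringBracket_node_apply s t hw, main w hw (hlt.trans hswap), sub_zero]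
      rcases lt_trichotomy (w.take s.size) s.word with h | h | h
      · rw [hs2 _ (by rw [List.length_take]; omega) h, zero_mul]
      · rcases lt_or_ge (w.drop s.size) t.word with h' | h'
        · rw [ht2 _ (by rw [List.length_drop]; omega) h', mul_zero]
        · exfalso
          rw [← List.take_append_drop s.size w, h] at hlt
          rcases h'.eq_or_lt with h' | h'
          · rw [← h'] at hlt; exact lt_irrefl _ hlt
          · exact lt_asymm hlt (List.append_left_lt h')
      · exfalso
        have := List.append_lt_append_of_length_eq h
          (by rw [List.length_take]; unfold size at *; omega) t.word (w.drop s.size)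
        rw [List.take_append_drop] at this
        exact lt_asymm hlt this

end NCSeries

/-! ### Magnus' theorem -/

namespace NCSeries

variable {r : ℕ}

open BracketTree PureBraid
open scoped IsMulCommutative

/-- The brackets of distinct Hall trees of the same size are linearly independent. -/
theorem ringBracket_linearIndependent {k : ℕ}
    (e : {t : BracketTree (Fin r) // t.Hall ∧ t.size = k} →₀ ℤ)
    (h : ∀ w : List (Fin r), w.length = k → e.sum (fun t n => n * t.1.ringBracket X w) = 0) :
    e = 0 := by
  by_contra hne
  -- Triangularity: at the least word occurring in the combination only the bracket t has a nonzero
  -- coefficient, namely 1.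
  obtain ⟨t, ht, hmin⟩ := Finset.exists_min_image e.support (fun t => t.1.word)
    (Finsupp.support_nonempty_iff.2 hne)
  have := h t.1.word t.2.2
  rw [Finsupp.sum, Finset.sum_eq_single t, (ringBracket_apply_of_lt t.2.1).1, mul_one] at this
  · exact Finsupp.mem_support_iff.1 ht this
  · intro s hs hst
    rw [(ringBracket_apply_of_lt s.2.1).2 _ (t.2.2.trans s.2.2.symm), mul_zero]
    refine (hmin s hs).lt_of_ne fun hw => hst ?_
    exact Subtype.ext (s.2.1.eq_of_word_eq t.2.1 hw.symm)
  · exact fun h => absurd ht h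

/-- An element of `Γ_k` of the free group is, modulo `Γ_{k+1}`, a combination of Hall brackets,
and the leading term of its Magnus expansion is the same combination of brackets. -/
theorem exists_hall_combination {k : ℕ} (hk : 1 ≤ k) {g : FreeGroup (Fin r)}
    (hg : g ∈ LC (FreeGroup (Fin r)) k) :
    ∃ e : {t : BracketTree (Fin r) // t.Hall ∧ t.size = k} →₀ ℤ,
      (e = 0 → g ∈ LC (FreeGroup (Fin r)) (k + 1)) ∧
      ∀ w : List (Fin r), w.length = k → ((magnus r g : NCSeries r) - 1) w =
        e.sum (fun t n => n * t.1.ringBracket X w) := by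
  let N := LC (FreeGroup (Fin r)) (k + 1)
  -- Γ_k is central modulo Γ_{k+1}. Its image therefore lies in a commutative group, viewed
  -- additively as a ℤ-module in which integral combinations of brackets make sense.
  have hcen : ∀ x ∈ LC (FreeGroup (Fin r)) k,
      (QuotientGroup.mk x : FreeGroup (Fin r) ⧸ N) ∈ Subgroup.center (FreeGroup (Fin r) ⧸ N) := by
    intro x hx
    rw [Subgroup.mem_center_iff]
    intro y
    induction y using QuotientGroup.induction_on with
    | H y =>
      rw [← commutatorElement_eq_one_iff_mul_comm, ← QuotientGroup.mk'_apply,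
        ← QuotientGroup.mk'_apply, ← map_commutatorElement, QuotientGroup.mk'_apply,
        QuotientGroup.eq_one_iff]
      exact commutator_mem_LC (i := 1) (Subgroup.mem_top y) hx (by omega)
  have hmem : ∀ t : {t : BracketTree (Fin r) // t.Hall ∧ t.size = k},
      t.1.groupBracket FreeGroup.of ∈ LC (FreeGroup (Fin r)) k :=
    fun t => by simpa [t.2.2] using groupBracket_mem_LC FreeGroup.of t.1
  let P : {t : BracketTree (Fin r) // t.Hall ∧ t.size = k} →
      Additive (Subgroup.center (FreeGroup (Fin r) ⧸ N)) :=
    fun t => Additive.ofMul ⟨_, hcen _ (hmem t)⟩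
  let φ := Finsupp.linearCombination ℤ P
  suffices H : ∃ e : {t : BracketTree (Fin r) // t.Hall ∧ t.size = k} →₀ ℤ,
      ((φ e).toMul : FreeGroup (Fin r) ⧸ N) = QuotientGroup.mk g ∧
      ∀ w : List (Fin r), w.length = k → ((magnus r g : NCSeries r) - 1) w =
        e.sum (fun t n => n * t.1.ringBracket X w) by
    obtain ⟨e, h1, h2⟩ := H
    refine ⟨e, ?_, h2⟩
    rintro rfl
    rw [map_zero] at h1
    exact (QuotientGroup.eq_one_iff g).1 h1.symm
  have hspan := LC_le_hallSpan_top (FreeGroup.of : Fin r → FreeGroup (Fin r))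
    (FreeGroup.closure_range_of _) hk hg
  suffices H : g ∈ LC (FreeGroup (Fin r)) k ∧
      ∃ e : {t : BracketTree (Fin r) // t.Hall ∧ t.size = k} →₀ ℤ,
      ((φ e).toMul : FreeGroup (Fin r) ⧸ N) = QuotientGroup.mk g ∧
      ∀ w : List (Fin r), w.length = k → ((magnus r g : NCSeries r) - 1) w =
        e.sum (fun t n => n * t.1.ringBracket X w) from H.2
  refine Subgroup.closure_induction (p := fun g _ => g ∈ LC (FreeGroup (Fin r)) k ∧
      ∃ e : {t : BracketTree (Fin r) // t.Hall ∧ t.size = k} →₀ ℤ,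
      ((φ e).toMul : FreeGroup (Fin r) ⧸ N) = QuotientGroup.mk g ∧
      ∀ w : List (Fin r), w.length = k → ((magnus r g : NCSeries r) - 1) w =
        e.sum (fun t n => n * t.1.ringBracket X w)) ?_ ?_ ?_ ?_ hspan
  · rintro _ (⟨t, h1, h2, -, rfl⟩ | h)
    · refine ⟨hmem ⟨t, h1, h2⟩, Finsupp.single ⟨t, h1, h2⟩ 1, ?_, fun w hw => ?_⟩
      · simp [φ, P]
      · rw [magnus_groupBracket_apply t (hw.trans h2.symm), Finsupp.sum_single_index] <;> simp
    · refine ⟨Γ_antitone _ (Nat.le_succ k) h, 0, ?_, fun w hw => ?_⟩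
      · rw [map_zero]
        exact ((QuotientGroup.eq_one_iff _).2 h).symm
      · rw [Finsupp.sum_zero_index]
        exact LC_le_magnusSubgroup (by omega) h w (by omega)
  · refine ⟨one_mem _, 0, by rw [map_zero]; rfl, fun w _ => ?_⟩
    rw [Finsupp.sum_zero_index, map_one, Units.val_one, sub_self]; rfl
  · rintro x y _ _ ⟨hx, e, h1, h2⟩ ⟨hy, e', h1', h2'⟩
    refine ⟨mul_mem hx hy, e + e', ?_, fun w hw => ?_⟩
    · rw [map_add, toMul_add, Subgroup.coe_mul, h1, h1']; rfl
    · rw [magnus_mul_apply hk (LC_le_magnusSubgroup hk hx) (LC_le_magnusSubgroup hk hy) hw,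
        h2 w hw, h2' w hw, Finsupp.sum_add_index']
      · simp
      · intros; ring
  · rintro x _ ⟨hx, e, h1, h2⟩
    refine ⟨inv_mem hx, -e, ?_, fun w hw => ?_⟩
    · rw [map_neg, toMul_neg, Subgroup.coe_inv, h1]; rfl
    · rw [magnus_inv_apply (LC_le_magnusSubgroup hk hx) hw, h2 w hw, Finsupp.sum_neg_index]
      · simp [Finsupp.sum]
      · simp

/-- **Magnus' theorem**: an element of the free group belongs to `Γ_k` if and only if its Magnus
expansion is `1` up to terms of degree at least `k`. -/
theorem magnusSubgroup_eq_LC {k : ℕ} (hk : 1 ≤ k) :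
    magnusSubgroup r k = LC (FreeGroup (Fin r)) k := by
  refine le_antisymm ?_ (LC_le_magnusSubgroup hk)
  induction k, hk using Nat.le_induction with
  | base => exact le_top
  | succ k hk ih =>
    intro g hg
    have hg' : g ∈ LC (FreeGroup (Fin r)) k := ih (VanishBelow.mono hg (Nat.le_succ k))
    obtain ⟨e, h1, h2⟩ := exists_hall_combination hk hg'
    -- The degree k part of the expansion is this combination of brackets. It vanishes, so
    -- independence forces every coefficient to be zero.
    refine h1 (ringBracket_linearIndependent e fun w hw => ?_)
    rw [← h2 w hw]
    exact hg w (by omega)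

end NCSeries

/-! ### The Hurwitz action and freeness of the last strand -/

namespace Braid

/-- The action of `σ_i` on sequences of pairs `(x, y)` of elements of a group. The first
components are acted upon by the Hurwitz action; the second ones record the conjugators. -/
def hurwitzFun {G : Type} [Group G] (i : ℕ) (t : ℕ → G × G) : ℕ → G × G := fun q =>
  if q = i then ((t i).1 * (t (i + 1)).1 * (t i).1⁻¹, (t i).1 * (t (i + 1)).2)
  else if q = i + 1 then t i else t q

section

variable {G : Type} [Group G]

theorem hurwitzFun_left (i : ℕ) (t : ℕ → G × G) : hurwitzFun i t i =
    ((t i).1 * (t (i + 1)).1 * (t i).1⁻¹, (t i).1 * (t (i + 1)).2) := by simp [hurwitzFun]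

theorem hurwitzFun_right (i : ℕ) (t : ℕ → G × G) : hurwitzFun i t (i + 1) = t i := by
  simp [hurwitzFun]

theorem hurwitzFun_of_ne {i q : ℕ} (h1 : q ≠ i) (h2 : q ≠ i + 1) (t : ℕ → G × G) :
    hurwitzFun i t q = t q := by
  simp [hurwitzFun, h1, h2]

/-- `hurwitzFun` as a permutation. -/
def hurwitz (G : Type) [Group G] (i : ℕ) : Equiv.Perm (ℕ → G × G) where
  toFun := hurwitzFun i
  invFun t q := if q = i then t (i + 1)
    else if q = i + 1 then ((t (i + 1)).1⁻¹ * (t i).1 * (t (i + 1)).1, (t (i + 1)).1⁻¹ * (t i).2)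
    else t q
  left_inv t := by
    funext q
    rcases eq_or_ne q i with rfl | h1
    · simp [hurwitzFun]
    · rcases eq_or_ne q (i + 1) with rfl | h2
      · simp [hurwitzFun, mul_assoc]
      · simp [hurwitzFun, h1, h2]
  right_inv t := by
    funext q
    rcases eq_or_ne q i with rfl | h1
    · simp [hurwitzFun, mul_assoc]
    · rcases eq_or_ne q (i + 1) with rfl | h2
      · simp [hurwitzFun]
      · simp [hurwitzFun, h1, h2]

theorem hurwitz_comm {i j : ℕ} (hij : i + 2 ≤ j) :
    hurwitz G i * hurwitz G j = hurwitz G j * hurwitz G i := by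
  ext1 t
  funext q
  change hurwitzFun i (hurwitzFun j t) q = hurwitzFun j (hurwitzFun i t) q
  rcases (by omega : q = i ∨ q = i + 1 ∨ q = j ∨ q = j + 1 ∨
    (q ≠ i ∧ q ≠ i + 1 ∧ q ≠ j ∧ q ≠ j + 1)) with rfl | rfl | rfl | rfl | ⟨h1, h2, h3, h4⟩
  all_goals
    simp (disch := omega) only [hurwitzFun_left, hurwitzFun_right, hurwitzFun_of_ne]

theorem hurwitz_braid (i : ℕ) : hurwitz G i * hurwitz G (i + 1) * hurwitz G i =
    hurwitz G (i + 1) * hurwitz G i * hurwitz G (i + 1) := by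
  ext1 t
  funext q
  change hurwitzFun i (hurwitzFun (i + 1) (hurwitzFun i t)) q =
    hurwitzFun (i + 1) (hurwitzFun i (hurwitzFun (i + 1) t)) q
  rcases (by omega : q = i ∨ q = i + 1 ∨ q = i + 1 + 1 ∨
    (q ≠ i ∧ q ≠ i + 1 ∧ q ≠ i + 1 + 1)) with rfl | rfl | rfl | ⟨h1, h2, h3⟩
  all_goals
    simp (disch := omega) only [hurwitzFun_left, hurwitzFun_right, hurwitzFun_of_ne]
  simp [mul_assoc]

/-- The Hurwitz action of the braid group. -/
def hurwitzHom (G : Type) [Group G] (n : ℕ) : Braid n →* Equiv.Perm (ℕ → G × G) :=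
  lift (hurwitz G) (fun _ _ h _ => hurwitz_comm h) (fun i _ => hurwitz_braid i)

/-- The sequence of the pairs `(x q, 1)` with `(1, h)` inserted at position `p`. -/
def inserted (x : ℕ → G) (p : ℕ) (h : G) : ℕ → G × G := fun q =>
  if q < p then (x q, 1) else if q = p then (1, h) else (x (q - 1), 1)

/-- The marked entry has first component 1, so passing it in this direction conjugates and
multiplies by 1 only. -/
theorem hurwitz_inserted (x : ℕ → G) (p : ℕ) (h : G) :
    hurwitz G p (inserted x p h) = inserted x (p + 1) h := by
  funext q
  change hurwitzFun p _ q = _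
  rcases (by omega : q = p ∨ q = p + 1 ∨ q < p ∨ p + 1 < q) with rfl | rfl | h' | h'
  · simp [hurwitzFun_left, inserted]
  · simp [hurwitzFun_right, inserted]
  · rw [hurwitzFun_of_ne (by omega) (by omega)]
    simp [inserted, h', show q < p + 1 by omega]
  · rw [hurwitzFun_of_ne (by omega) (by omega)]
    simp [inserted, show ¬ q < p by omega, show ¬ q < p + 1 by omega, show q ≠ p by omega,
      show q ≠ p + 1 by omega]

/-- In the opposite direction the marked entry is conjugated by x p. Its first component 1 is
unchanged, while its second component records the factor x p. -/
theorem hurwitz_inserted_succ (x : ℕ → G) (p : ℕ) (h : G) :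
    hurwitz G p (inserted x (p + 1) h) = inserted x p (x p * h) := by
  funext q
  change hurwitzFun p _ q = _
  rcases (by omega : q = p ∨ q = p + 1 ∨ q < p ∨ p + 1 < q) with rfl | rfl | h' | h'
  · simp [hurwitzFun_left, inserted]
  · simp [hurwitzFun_right, inserted]
  · rw [hurwitzFun_of_ne (by omega) (by omega)]
    simp [inserted, h', show q < p + 1 by omega]
  · rw [hurwitzFun_of_ne (by omega) (by omega)]
    simp [inserted, show ¬ q < p by omega, show ¬ q < p + 1 by omega, show q ≠ p by omega,
      show q ≠ p + 1 by omega]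

theorem hurwitzHom_s {n i : ℕ} (hi : i + 1 < n) : hurwitzHom G n (s n i) = hurwitz G i :=
  lift_s _ _ _ hi

theorem hurwitzHom_range' (x : ℕ → G) (h : G) (N p l : ℕ) (hN : p + l < N) :
    hurwitzHom G N ((List.range' p l).reverse.map (s N)).prod (inserted x p h) =
      inserted x (p + l) h := by
  induction l with
  | zero => simp
  | succ l ih =>
    rw [List.range'_concat, List.reverse_append, List.map_append, List.prod_append, map_mul,
      Equiv.Perm.mul_apply, ih (by omega)]
    simp only [List.reverse_singleton, List.map_singleton, List.prod_singleton, one_mul]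
    rw [hurwitzHom_s (by omega), hurwitz_inserted]
    rfl

/-- The conjugator only transports the marked entry between the positions n and j + 1. The square of
σ_j takes it around x j once and contributes this single factor. -/
theorem hurwitzHom_lastGen (x : ℕ → G) (h : G) (n : ℕ) (j : Fin n) :
    hurwitzHom G (n + 1) (PureBraid.lastGen n j : Braid (n + 1)) (inserted x n h) =
      inserted x n (x j * h) := by
  have hj := j.2
  have key : ∀ h, hurwitzHom G (n + 1)
      ((List.range' (j + 1) (n - 1 - j)).reverse.map (s (n + 1))).prod (inserted x (j + 1) h) =
      inserted x n h := by
    intro h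
    rw [hurwitzHom_range' x h (n + 1) (j + 1) (n - 1 - j) (by omega)]
    congr 1; omega
  simp only [PureBraid.lastGen, map_mul, map_inv, Equiv.Perm.mul_apply]
  rw [Equiv.Perm.inv_eq_iff_eq.2 (key h).symm, hurwitzHom_s (by omega), hurwitz_inserted_succ,
    hurwitz_inserted, key]

end

end Braid

namespace PureBraid

open Braid

theorem ofFree_of (n : ℕ) (j : Fin n) : ofFree n (FreeGroup.of j) = lastGen n j := by
  simp [ofFree]

theorem hurwitzHom_ofFree (n : ℕ) (w h : FreeGroup (Fin n)) :
    hurwitzHom _ (n + 1) (ofFree n w : Braid (n + 1))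
      (inserted (fun q => if hq : q < n then FreeGroup.of ⟨q, hq⟩ else 1) n h) =
      inserted (fun q => if hq : q < n then FreeGroup.of ⟨q, hq⟩ else 1) n (w * h) := by
  induction w using FreeGroup.induction_on generalizing h with
  | C1 => simp
  | of j => simp [ofFree_of, hurwitzHom_lastGen]
  | inv_of j ih =>
    rw [map_inv, Subgroup.coe_inv, map_inv, Equiv.Perm.inv_eq_iff_eq, ih, mul_inv_cancel_left]
  | mul a b ha hb =>
    rw [map_mul, Subgroup.coe_mul, map_mul, Equiv.Perm.mul_apply, hb, ha, mul_assoc]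

/-- The last strands of pure braids on `n + 1` strands generate a free group. -/
theorem ofFree_injective (n : ℕ) : Function.Injective (ofFree n) := by
  rw [injective_iff_map_eq_one]
  intro w hw
  -- Starting from h = 1, the second component at position n after acting is w itself.
  have := congrFun (hurwitzHom_ofFree n w 1) n
  rw [hw] at this
  simpa [inserted] using this.symm

end PureBraid

/-! ### Deletion after adding or doubling a strand -/

namespace Braid

theorem del_mul {n : ℕ} (a b : Braid (n + 1)) (q : Fin (n + 1)) :
    (del n (a * b)).left q = (del n a).left q * (del n b).left ((perm (n + 1) a)⁻¹ q) := by
  rw [map_mul, left_mul, del_right]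

theorem del_inv {n : ℕ} (a : Braid (n + 1)) (q : Fin (n + 1)) :
    (del n a⁻¹).left q = ((del n a).left (perm (n + 1) a q))⁻¹ := by
  rw [map_inv, left_inv, del_right]

theorem dbl_mul {n : ℕ} (a b : Braid n) (q : Fin n) :
    (dbl n (a * b)).left q = (dbl n a).left q * (dbl n b).left ((perm n a)⁻¹ q) := by
  rw [map_mul, left_mul, dbl_right]

theorem dbl_inv {n : ℕ} (a : Braid n) (q : Fin n) :
    (dbl n a⁻¹).left q = ((dbl n a).left (perm n a q))⁻¹ := by
  rw [map_inv, left_inv, dbl_right]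

theorem del_one {n : ℕ} (q : Fin (n + 1)) : (del n 1).left q = 1 := by rw [map_one]; rfl

theorem dbl_one {n : ℕ} (q : Fin n) : (dbl n 1).left q = 1 := by rw [map_one]; rfl

theorem del_s_mul_s {n i j : ℕ} (hi : i < n) (hj : j < n) (q : Fin (n + 1)) :
    (del n (s (n + 1) i * s (n + 1) j)).left q = delGen n i q * delGen n j (trN i q) := by
  rw [del_mul, del_s hi, del_s hj, perm_s (by omega), tr_inv, tr_val' (by omega)]

theorem addRight_s {n i : ℕ} (hi : i + 1 < n) : addRight n (s n i) = s (n + 1) i :=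
  lift_s _ _ _ hi

theorem addLeft_s {n i : ℕ} (hi : i + 1 < n) : addLeft n (s n i) = s (n + 1) (i + 1) :=
  lift_s _ _ _ hi

theorem perm_addRight {n : ℕ} (β : Braid n) :
    (∀ r : Fin n, perm (n + 1) (addRight n β) r.castSucc = (perm n β r).castSucc) ∧
      perm (n + 1) (addRight n β) (Fin.last n) = Fin.last n := by
  induction β using Braid.induction with
  | one => simp
  | gen i hi =>
    have h1 : i + 1 < n + 1 := by omega
    rw [addRight_s hi, perm_s h1, perm_s hi]
    refine ⟨fun r => Fin.ext ?_, Fin.ext ?_⟩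
    · rw [tr_val h1, Fin.val_castSucc, Fin.val_castSucc, tr_val hi]
    · rw [tr_val h1, Fin.val_last]
      split_ifs <;> omega
  | mul a b ha hb => simp [ha.1, ha.2, hb.1, hb.2]
  | inv a ha =>
    simp only [map_inv]
    refine ⟨fun r => ?_, ?_⟩
    · rw [Equiv.Perm.inv_eq_iff_eq, ha.1]; simp
    · rw [Equiv.Perm.inv_eq_iff_eq, ha.2]

theorem perm_addLeft {n : ℕ} (β : Braid n) :
    (∀ r : Fin n, perm (n + 1) (addLeft n β) r.succ = (perm n β r).succ) ∧
      perm (n + 1) (addLeft n β) 0 = 0 := by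
  induction β using Braid.induction with
  | one => simp
  | gen i hi =>
    have h1 : i + 1 + 1 < n + 1 := by omega
    rw [addLeft_s hi, perm_s h1, perm_s hi]
    refine ⟨fun r => Fin.ext ?_, Fin.ext ?_⟩
    · rw [tr_val h1, Fin.val_succ, Fin.val_succ, tr_val hi]
      split_ifs <;> omega
    · rw [tr_val h1, Fin.val_zero]
      split_ifs <;> omega
  | mul a b ha hb => simp [ha.1, ha.2, hb.1, hb.2]
  | inv a ha =>
    simp only [map_inv]
    refine ⟨fun r => ?_, ?_⟩
    · rw [Equiv.Perm.inv_eq_iff_eq, ha.1]; simp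
    · rw [Equiv.Perm.inv_eq_iff_eq, ha.2]

theorem del_addRight_last {n : ℕ} (β : Braid n) :
    (del n (addRight n β)).left (Fin.last n) = β := by
  induction β using Braid.induction with
  | one => rw [map_one, del_one]
  | gen i hi => rw [addRight_s hi, del_s (by omega), delGen_gt (by simpa using hi)]
  | mul a b ha hb =>
    rw [map_mul, del_mul, ha, Equiv.Perm.inv_eq_iff_eq.2 (perm_addRight a).2.symm, hb]
  | inv a ha => rw [map_inv, del_inv, (perm_addRight a).2, ha]

theorem del_addLeft_zero {n : ℕ} (β : Braid n) : (del n (addLeft n β)).left 0 = β := by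
  induction β using Braid.induction with
  | one => rw [map_one, del_one]
  | gen i hi => rw [addLeft_s hi, del_s (by omega), delGen_lt (by simp)]; rfl
  | mul a b ha hb =>
    rw [map_mul, del_mul, ha, Equiv.Perm.inv_eq_iff_eq.2 (perm_addLeft a).2.symm, hb]
  | inv a ha => rw [map_inv, del_inv, (perm_addLeft a).2, ha]

theorem del_addRight_castSucc {n : ℕ} (β : Braid (n + 1)) : ∀ q : Fin (n + 1),
    (del (n + 1) (addRight (n + 1) β)).left q.castSucc = addRight n ((del n β).left q) := by
  induction β using Braid.induction with
  | one => intro q; rw [map_one, del_one, del_one, map_one]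
  | gen i hi =>
    intro q
    have hq := q.2
    rw [addRight_s hi, del_s (by omega), del_s (by omega), Fin.val_castSucc]
    rcases (by omega : (q : ℕ) < i ∨ (i ≤ (q : ℕ) ∧ (q : ℕ) ≤ i + 1) ∨ i + 1 < (q : ℕ)) with
      h | h | h
    · rw [delGen_lt h, delGen_lt h, addRight_s (by omega)]
    · rw [delGen_mid h.1 h.2, delGen_mid h.1 h.2, map_one]
    · rw [delGen_gt h, delGen_gt h, addRight_s (by omega)]
  | mul a b ha hb =>
    intro q
    rw [map_mul, del_mul, del_mul, map_mul, ha, ← hb]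
    congr 1
    refine congrArg _ ?_
    rw [Equiv.Perm.inv_eq_iff_eq, (perm_addRight a).1]
    simp
  | inv a ha =>
    intro q
    rw [map_inv, del_inv, del_inv, (perm_addRight a).1, ha, map_inv]

theorem del_addLeft_succ {n : ℕ} (β : Braid (n + 1)) : ∀ q : Fin (n + 1),
    (del (n + 1) (addLeft (n + 1) β)).left q.succ = addLeft n ((del n β).left q) := by
  induction β using Braid.induction with
  | one => intro q; rw [map_one, del_one, del_one, map_one]
  | gen i hi =>
    intro q
    have hq := q.2
    rw [addLeft_s hi, del_s (by omega), del_s (by omega), Fin.val_succ]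
    rcases (by omega : (q : ℕ) < i ∨ (i ≤ (q : ℕ) ∧ (q : ℕ) ≤ i + 1) ∨ i + 1 < (q : ℕ)) with
      h | h | h
    · rw [delGen_lt (by omega), delGen_lt h, addLeft_s (by omega)]
      congr 1; omega
    · rw [delGen_mid (by omega) (by omega), delGen_mid h.1 h.2, map_one]
    · rw [delGen_gt (by omega), delGen_gt h, addLeft_s (by omega)]
  | mul a b ha hb =>
    intro q
    rw [map_mul, del_mul, del_mul, map_mul, ha, ← hb]
    congr 1
    refine congrArg _ ?_
    rw [Equiv.Perm.inv_eq_iff_eq, (perm_addLeft a).1]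
    simp
  | inv a ha =>
    intro q
    rw [map_inv, del_inv, del_inv, (perm_addLeft a).1, ha, map_inv]

theorem succ_succAbove_self {n : ℕ} (q : Fin n) : q.succ.succAbove q = q.castSucc := by
  ext; simp

theorem castSucc_succAbove_self' {n : ℕ} (q : Fin n) : q.castSucc.succAbove q = q.succ := by
  ext; simp

theorem perm_dbl_castSucc {n : ℕ} (β : Braid n) (q : Fin n) :
    perm (n + 1) ((dbl n β).left q) ((perm n β)⁻¹ q).castSucc = q.castSucc := by
  have := perm_dbl _ (Or.inl rfl) β q ((perm n β)⁻¹ q)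
  simpa only [succ_succAbove_self, Equiv.Perm.coe_inv, Equiv.apply_symm_apply] using this

theorem perm_dbl_succ {n : ℕ} (β : Braid n) (q : Fin n) :
    perm (n + 1) ((dbl n β).left q) ((perm n β)⁻¹ q).succ = q.succ := by
  have := perm_dbl _ (Or.inr rfl) β q ((perm n β)⁻¹ q)
  simpa only [castSucc_succAbove_self', Equiv.Perm.coe_inv, Equiv.apply_symm_apply] using this

theorem del_dbl_castSucc {n : ℕ} (β : Braid n) : ∀ q : Fin n,
    (del n ((dbl n β).left q)).left q.castSucc = β := by
  induction β using Braid.induction with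
  | one => intro q; rw [dbl_one, del_one]
  | gen i hi =>
    intro q
    rw [dbl_s hi]
    rcases (by omega : (q : ℕ) < i ∨ (q : ℕ) = i ∨ (q : ℕ) = i + 1 ∨ i + 1 < (q : ℕ)) with
      h | h | h | h
    · rw [dblGen_lt h, del_s (by omega), delGen_lt (by rw [Fin.val_castSucc]; omega)]; rfl
    · rw [h, dblGen_left, del_s_mul_s (by omega) (by omega), Fin.val_castSucc, h,
        delGen_lt (by omega), trN_lt (by omega), delGen_mid (by omega) (by omega)]; simp
    · rw [h, dblGen_right, del_s_mul_s (by omega) (by omega), Fin.val_castSucc, h, trN_right,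
        delGen_mid (by omega) (by omega), delGen_lt (by omega)]; simp
    · rw [dblGen_gt h, del_s (by omega), delGen_gt (by rw [Fin.val_castSucc]; omega)]
  | mul a b ha hb =>
    intro q
    rw [dbl_mul, del_mul, ha, Equiv.Perm.inv_eq_iff_eq.2 (perm_dbl_castSucc a q).symm, hb]
  | inv a ha =>
    intro q
    have := perm_dbl_castSucc a (perm n a q)
    simp only [Equiv.Perm.coe_inv, Equiv.symm_apply_apply] at this
    rw [dbl_inv, del_inv, this, ha]

theorem del_dbl_succ {n : ℕ} (β : Braid n) : ∀ q : Fin n,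
    (del n ((dbl n β).left q)).left q.succ = β := by
  induction β using Braid.induction with
  | one => intro q; rw [dbl_one, del_one]
  | gen i hi =>
    intro q
    rw [dbl_s hi]
    rcases (by omega : (q : ℕ) < i ∨ (q : ℕ) = i ∨ (q : ℕ) = i + 1 ∨ i + 1 < (q : ℕ)) with
      h | h | h | h
    · rw [dblGen_lt h, del_s (by omega), delGen_lt (by rw [Fin.val_succ]; omega)]; rfl
    · rw [h, dblGen_left, del_s_mul_s (by omega) (by omega), Fin.val_succ, h,
        delGen_mid (by omega) (by omega), trN_left, delGen_gt (by omega)]; simp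
    · rw [h, dblGen_right, del_s_mul_s (by omega) (by omega), Fin.val_succ, h,
        delGen_gt (by omega), trN_gt (by omega), delGen_mid (by omega) (by omega)]; simp
    · rw [dblGen_gt h, del_s (by omega), delGen_gt (by rw [Fin.val_succ]; omega)]
  | mul a b ha hb =>
    intro q
    rw [dbl_mul, del_mul, ha, Equiv.Perm.inv_eq_iff_eq.2 (perm_dbl_succ a q).symm, hb]
  | inv a ha =>
    intro q
    have := perm_dbl_succ a (perm n a q)
    simp only [Equiv.Perm.coe_inv, Equiv.symm_apply_apply] at this
    rw [dbl_inv, del_inv, this, ha]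

theorem succAbove_perm_del_inv {n : ℕ} (a : Braid (n + 1)) (r : Fin (n + 1)) (q : Fin n) :
    (perm (n + 1) a)⁻¹ (r.succAbove q) =
      ((perm (n + 1) a)⁻¹ r).succAbove ((perm n ((del n a).left r))⁻¹ q) := by
  rw [Equiv.Perm.inv_eq_iff_eq, ← perm_del]
  simp

/-- Doubling one strand commutes with deleting another. The doubled position `r.succAbove q` differs
from r by construction, and `(r.succAbove q).succ.succAbove r` is where r sits once the copy is
present. On a generator this is a check of both positions against the crossing. -/
theorem del_dbl {n : ℕ} (β : Braid (n + 1)) : ∀ (r : Fin (n + 1)) (q : Fin n),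
    (del (n + 1) ((dbl (n + 1) β).left (r.succAbove q))).left
      ((r.succAbove q).succ.succAbove r) = (dbl n ((del n β).left r)).left q := by
  induction β using Braid.induction with
  | one => intro r q; rw [dbl_one, del_one, del_one, dbl_one]
  | gen i hi =>
    intro r q
    have hr := r.2
    have hq := q.2
    have hQ := succAbove_val r q
    have hR := succAbove_val (r.succAbove q).succ r
    rw [Fin.val_succ, hQ] at hR
    rw [dbl_s hi, del_s (by omega)]
    generalize r.succAbove q = Q at *
    generalize Q.succ.succAbove r = R at *
    rcases (by omega : (r : ℕ) < i ∨ (r : ℕ) = i ∨ (r : ℕ) = i + 1 ∨ i + 1 < (r : ℕ)) with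
      h | h | h | h
    · obtain ⟨k, rfl⟩ : ∃ k, i = k + 1 := ⟨i - 1, by omega⟩
      rw [delGen_lt h, show k + 1 - 1 = k from rfl, dbl_s (by omega)]
      rcases (by omega : (q : ℕ) < k ∨ (q : ℕ) = k ∨ (q : ℕ) = k + 1 ∨ k + 1 < (q : ℕ)) with
        h' | h' | h' | h'
      · rw [dblGen_lt h', dblGen_lt (by split_ifs at hQ <;> omega), del_s (by omega),
          delGen_lt (by split_ifs at hR <;> omega)]; rfl
      · rw [h', dblGen_left, show (Q : ℕ) = k + 1 by split_ifs at hQ <;> omega, dblGen_left,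
          del_s_mul_s (by omega) (by omega), show (R : ℕ) = r by split_ifs at hR <;> omega,
          trN_lt (by omega), delGen_lt (by omega), delGen_lt (by omega)]; rfl
      · rw [h', dblGen_right, show (Q : ℕ) = k + 1 + 1 by split_ifs at hQ <;> omega, dblGen_right,
          del_s_mul_s (by omega) (by omega), show (R : ℕ) = r by split_ifs at hR <;> omega,
          trN_lt (by omega), delGen_lt (by omega), delGen_lt (by omega)]; rfl
      · rw [dblGen_gt h', dblGen_gt (by split_ifs at hQ <;> omega), del_s (by omega),
          delGen_lt (by split_ifs at hR <;> omega)]; rfl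
    · rw [delGen_mid (by omega) (by omega), dbl_one]
      rcases (by omega : (q : ℕ) < i ∨ (q : ℕ) = i ∨ i < (q : ℕ)) with h' | h' | h'
      · rw [dblGen_lt (by split_ifs at hQ <;> omega), del_s (by omega),
          delGen_mid (by split_ifs at hR <;> omega) (by split_ifs at hR <;> omega)]
      · rw [show (Q : ℕ) = i + 1 by split_ifs at hQ <;> omega, dblGen_right,
          del_s_mul_s (by omega) (by omega), show (R : ℕ) = i by split_ifs at hR <;> omega,
          trN_left, delGen_mid (by omega) (by omega), delGen_mid (by omega) (by omega), one_mul]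
      · rw [dblGen_gt (by split_ifs at hQ <;> omega), del_s (by omega),
          delGen_mid (by split_ifs at hR <;> omega) (by split_ifs at hR <;> omega)]
    · rw [delGen_mid (by omega) (by omega), dbl_one]
      rcases (by omega : (q : ℕ) < i ∨ (q : ℕ) = i ∨ i < (q : ℕ)) with h' | h' | h'
      · rw [dblGen_lt (by split_ifs at hQ <;> omega), del_s (by omega),
          delGen_mid (by split_ifs at hR <;> omega) (by split_ifs at hR <;> omega)]
      · rw [show (Q : ℕ) = i by split_ifs at hQ <;> omega, dblGen_left,
          del_s_mul_s (by omega) (by omega), show (R : ℕ) = i + 1 + 1 by split_ifs at hR <;> omega,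
          trN_right, delGen_mid (by omega) (by omega), delGen_mid (by omega) (by omega), one_mul]
      · rw [dblGen_gt (by split_ifs at hQ <;> omega), del_s (by omega),
          delGen_mid (by split_ifs at hR <;> omega) (by split_ifs at hR <;> omega)]
    · rw [delGen_gt h, dbl_s (by omega)]
      rcases (by omega : (q : ℕ) < i ∨ (q : ℕ) = i ∨ (q : ℕ) = i + 1 ∨ i + 1 < (q : ℕ)) with
        h' | h' | h' | h'
      · rw [dblGen_lt h', dblGen_lt (by split_ifs at hQ <;> omega), del_s (by omega),
          delGen_gt (by split_ifs at hR <;> omega)]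
      · have hR' : i + 2 < (R : ℕ) := by split_ifs at hR <;> omega
        rw [h', dblGen_left, show (Q : ℕ) = i by split_ifs at hQ <;> omega, dblGen_left,
          del_s_mul_s (by omega) (by omega),
          trN_gt (by omega), delGen_gt (by omega), delGen_gt (by omega)]
      · have hR' : i + 2 < (R : ℕ) := by split_ifs at hR <;> omega
        rw [h', dblGen_right, show (Q : ℕ) = i + 1 by split_ifs at hQ <;> omega, dblGen_right,
          del_s_mul_s (by omega) (by omega),
          trN_gt (by omega), delGen_gt (by omega), delGen_gt (by omega)]
      · rw [dblGen_gt h', dblGen_gt (by split_ifs at hQ <;> omega), del_s (by omega),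
          delGen_gt (by split_ifs at hR <;> omega)]
  | mul a b ha hb =>
    intro r q
    rw [dbl_mul, del_mul, ha, del_mul, dbl_mul, ← hb]
    congr 1
    rw [← succAbove_perm_del_inv]
    refine congrArg _ ?_
    rw [Equiv.Perm.inv_eq_iff_eq, perm_dbl _ (Or.inl rfl)]
    simp
  | inv a ha =>
    intro r q
    have e1 : perm (n + 1) a (r.succAbove q) =
        (perm (n + 1) a r).succAbove (perm n ((del n a).left (perm (n + 1) a r)) q) := by
      rw [perm_del]; simp
    rw [dbl_inv, del_inv, del_inv, dbl_inv, ← ha, e1]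
    congr 3
    rw [← e1]
    have := perm_dbl _ (Or.inl rfl) a (perm (n + 1) a (r.succAbove q)) r
    exact congrArg _ (by simpa using this)

end Braid

/-! ### Generators of the kernel of the last deletion -/

section BraidWords

variable {G : Type} [Group G] {a b d : G}

/-- With a, b, d the three Artin generators of B_4, this says that σ_0 conjugates A_{04} to A_{14}
(strands counted from 0). With d = 1 and shifted generators it gives the action of σ_1 on A_{14}. -/
theorem braid_conj_first (h1 : a * b * a = b * a * b) (h3 : a * d = d * a) :
    a * (d * b * (a * a) * (d * b)⁻¹) * a⁻¹ = d * (b * b) * d⁻¹ := by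
  have h3' : a * d⁻¹ = d⁻¹ * a := (show Commute a d from h3).inv_right
  rw [mul_inv_eq_iff_eq_mul]
  calc a * (d * b * (a * a) * (d * b)⁻¹) = (a * d) * b * (a * a) * b⁻¹ * d⁻¹ := by group
    _ = d * (a * b * a) * a * b⁻¹ * d⁻¹ := by rw [h3]; group
    _ = d * (b * a * b) * a * b⁻¹ * d⁻¹ := by rw [h1]
    _ = d * b * (a * b * a) * b⁻¹ * d⁻¹ := by group
    _ = d * b * b * (a * d⁻¹) := by rw [h1]; group
    _ = _ := by rw [h3']; group

theorem braid_conj_first_mul (h1 : a * b * a = b * a * b) (h3 : a * d = d * a) :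
    a * ((d * b * (a * a) * (d * b)⁻¹) * (d * (b * b) * d⁻¹)) * a⁻¹ =
      (d * b * (a * a) * (d * b)⁻¹) * (d * (b * b) * d⁻¹) := by
  have h3' : a * d⁻¹ = d⁻¹ * a := (show Commute a d from h3).inv_right
  rw [mul_inv_eq_iff_eq_mul]
  calc a * ((d * b * (a * a) * (d * b)⁻¹) * (d * (b * b) * d⁻¹))
      = (a * d) * b * a * a * b * d⁻¹ := by group
    _ = d * (a * b * a) * a * b * d⁻¹ := by rw [h3]; group
    _ = d * b * a * (b * a * b) * d⁻¹ := by rw [h1]; group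
    _ = d * b * a * a * b * (a * d⁻¹) := by rw [← h1]; group
    _ = _ := by rw [h3']; group

/-- Knowing that x goes to y and that xy is fixed determines the conjugates of both elements by a
and by its inverse, all as words in x and y. -/
theorem conj_mem_of_conj_eq {R : Subgroup G} {x y : G} (hx : x ∈ R) (hy : y ∈ R)
    (e1 : a * x * a⁻¹ = y) (e2 : a * (x * y) * a⁻¹ = x * y) :
    (a * x * a⁻¹ ∈ R ∧ a * y * a⁻¹ ∈ R) ∧ (a⁻¹ * x * a⁻¹⁻¹ ∈ R ∧ a⁻¹ * y * a⁻¹⁻¹ ∈ R) := by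
  refine ⟨⟨e1 ▸ hy, ?_⟩, ?_, ?_⟩
  · have : a * y * a⁻¹ = y⁻¹ * (x * y) := by
      rw [← e2, ← e1]; group
    rw [this]
    exact mul_mem (inv_mem hy) (mul_mem hx hy)
  · have : a⁻¹ * x * a⁻¹⁻¹ = x * y * x⁻¹ := by
      nth_rewrite 1 [show x = x * y * y⁻¹ by group]
      nth_rewrite 1 [← e2]
      rw [← e1]; group
    rw [this]
    exact mul_mem (mul_mem hx hy) (inv_mem hx)
  · have : a⁻¹ * y * a⁻¹⁻¹ = x := by rw [← e1]; group
    rw [this]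
    exact hx

theorem braid_conj_far (h2 : b * d * b = d * b * d) (h3 : a * d = d * a) :
    b * (d * b * (a * a) * (d * b)⁻¹) * b⁻¹ = d * b * (a * a) * (d * b)⁻¹ := by
  rw [mul_inv_eq_iff_eq_mul]
  have e : d * b⁻¹ * d⁻¹ = b⁻¹ * d⁻¹ * b := by
    rw [mul_inv_eq_iff_eq_mul, mul_inv_eq_iff_eq_mul]
    calc d = b⁻¹ * d⁻¹ * (d * b * d) := by group
      _ = _ := by rw [← h2]; group
  calc b * (d * b * (a * a) * (d * b)⁻¹) = (b * d * b) * (a * a) * b⁻¹ * d⁻¹ := by group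
    _ = d * b * (d * a) * a * b⁻¹ * d⁻¹ := by rw [h2]; group
    _ = d * b * (a * d) * a * b⁻¹ * d⁻¹ := by rw [h3]
    _ = d * b * a * (d * a) * b⁻¹ * d⁻¹ := by group
    _ = d * b * a * (a * d) * b⁻¹ * d⁻¹ := by rw [h3]
    _ = d * b * a * a * (d * b⁻¹ * d⁻¹) := by group
    _ = _ := by rw [e]; group

end BraidWords

namespace Braid

theorem del_s_mul {n i : ℕ} (hi : i < n) (β : Braid (n + 1)) (q : Fin (n + 1)) :
    (del n (s (n + 1) i * β)).left q = delGen n i q * (del n β).left (tr (n + 1) i q) := by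
  rw [del_mul, del_s hi, perm_s (by omega), tr_inv]

theorem del_s_inv {n i : ℕ} (hi : i < n) (q : Fin (n + 1)) :
    (del n (s (n + 1) i)⁻¹).left q = (delGen n i (tr (n + 1) i q : Fin (n + 1)))⁻¹ := by
  rw [del_inv, del_s hi, perm_s (by omega)]

theorem del_s_inv_mul {n i : ℕ} (hi : i < n) (β : Braid (n + 1)) (q : Fin (n + 1)) :
    (del n ((s (n + 1) i)⁻¹ * β)).left q =
      (delGen n i (tr (n + 1) i q : Fin (n + 1)))⁻¹ * (del n β).left (tr (n + 1) i q) := by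
  rw [del_mul, del_s_inv hi, map_inv, perm_s (by omega), inv_inv]

end Braid

namespace PureBraid

open Braid

theorem lastGen_three_zero : (lastGen 3 0 : Braid 4) =
    s 4 2 * s 4 1 * (s 4 0 * s 4 0) * (s 4 2 * s 4 1)⁻¹ := by
  simp [lastGen, List.range']

theorem lastGen_three_one : (lastGen 3 1 : Braid 4) =
    s 4 2 * (s 4 1 * s 4 1) * (s 4 2)⁻¹ := by
  simp [lastGen]

theorem lastGen_three_two : (lastGen 3 2 : Braid 4) = s 4 2 * s 4 2 := by
  simp [lastGen]

theorem tr_four_table : (tr 4 0 0 = 1 ∧ tr 4 0 1 = 0 ∧ tr 4 0 2 = 2 ∧ tr 4 0 3 = 3) ∧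
    (tr 4 1 0 = 0 ∧ tr 4 1 1 = 2 ∧ tr 4 1 2 = 1 ∧ tr 4 1 3 = 3) ∧
    (tr 4 2 0 = 0 ∧ tr 4 2 1 = 1 ∧ tr 4 2 2 = 3 ∧ tr 4 2 3 = 2) := by decide

theorem lastGen_two_zero : (lastGen 2 0 : Braid 3) = s 3 1 * (s 3 0 * s 3 0) * (s 3 1)⁻¹ := by
  simp [lastGen]

theorem lastGen_two_one : (lastGen 2 1 : Braid 3) = s 3 1 * s 3 1 := by
  simp [lastGen]

theorem delete_lastGen (q : Fin 4) (j : Fin 3) : delete q (lastGen 3 j) =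
    ![![1, lastGen 2 0, lastGen 2 1], ![lastGen 2 0, 1, lastGen 2 1],
      ![lastGen 2 0, lastGen 2 1, 1], ![1, 1, 1]] q j := by
  obtain ⟨⟨a0, a1, a2, a3⟩, ⟨b0, b1, b2, b3⟩, d0, d1, d2, d3⟩ := tr_four_table
  refine Subtype.ext ?_
  change (del 3 (lastGen 3 j)).left q = _
  -- With words associated to the right, the deletion rules peel off one generator at a time while
  -- `tr_four_table` tracks the position of the deleted strand.
  fin_cases j <;> fin_cases q <;>
    simp only [lastGen_three_zero, lastGen_three_one, lastGen_three_two, Fin.zero_eta, Fin.mk_one,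
      Fin.reduceFinMk, mul_assoc, mul_inv_rev] <;>
    simp (disch := omega) only [del_s_mul, del_s_inv_mul, del_s, del_s_inv,
      a0, a1, a2, a3, b0, b1, b2, b3, d0, d1, d2, d3] <;>
    simp [delGen, lastGen_two_zero, lastGen_two_one, mul_assoc]


/-- The image of `ofFree 3` in the braid group. -/
def lastStrandSubgroup : Subgroup (Braid 4) := (ofFree 3).range.map (perm 4).ker.subtype

theorem lastGen_mem (j : Fin 3) : (lastGen 3 j : Braid 4) ∈ lastStrandSubgroup :=
  ⟨lastGen 3 j, ⟨FreeGroup.of j, ofFree_of 3 j⟩, rfl⟩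

theorem conj_mem_lastStrandSubgroup {x : Braid 4}
    (h : ∀ j, x * lastGen 3 j * x⁻¹ ∈ lastStrandSubgroup) {y : Braid 4}
    (hy : y ∈ lastStrandSubgroup) : x * y * x⁻¹ ∈ lastStrandSubgroup := by
  obtain ⟨_, ⟨w, rfl⟩, rfl⟩ := hy
  change x * (ofFree 3 w : Braid 4) * x⁻¹ ∈ _
  induction w using FreeGroup.induction_on with
  | C1 => simp
  | of j => rw [ofFree_of]; exact h j
  | inv_of j ih =>
    have := inv_mem ih
    rw [mul_inv_rev, mul_inv_rev, inv_inv, ← mul_assoc] at this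
    rwa [map_inv]
  | mul u v hu hv =>
    have := mul_mem hu hv
    rwa [show x * (ofFree 3 u : Braid 4) * x⁻¹ * (x * (ofFree 3 v : Braid 4) * x⁻¹) =
      x * ((ofFree 3 u : Braid 4) * (ofFree 3 v : Braid 4)) * x⁻¹ by group, ← Subgroup.coe_mul,
      ← map_mul] at this

theorem conj_s_zero_mem (j : Fin 3) : s 4 0 * lastGen 3 j * (s 4 0)⁻¹ ∈ lastStrandSubgroup ∧
    (s 4 0)⁻¹ * lastGen 3 j * (s 4 0)⁻¹⁻¹ ∈ lastStrandSubgroup := by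
  have h1 : s 4 0 * s 4 1 * s 4 0 = _ := s_braid (n := 4) (i := 0) (by omega)
  have h3 : s 4 0 * s 4 2 = _ := s_comm (n := 4) (i := 0) le_rfl
  have key := conj_mem_of_conj_eq (a := s 4 0) (lastGen_mem 0) (lastGen_mem 1)
    (by rw [lastGen_three_zero, lastGen_three_one]; exact braid_conj_first h1 h3)
    (by rw [lastGen_three_zero, lastGen_three_one]; exact braid_conj_first_mul h1 h3)
  fin_cases j
  · exact ⟨key.1.1, key.2.1⟩
  · exact ⟨key.1.2, key.2.2⟩
  · have hc : Commute (s 4 0) (lastGen 3 2 : Braid 4) := by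
      rw [lastGen_three_two]
      exact (show Commute (s 4 0) (s 4 2) from h3).mul_right h3
    constructor
    · change s 4 0 * lastGen 3 2 * (s 4 0)⁻¹ ∈ _
      rw [hc.eq, mul_inv_cancel_right]
      exact lastGen_mem 2
    · change (s 4 0)⁻¹ * lastGen 3 2 * (s 4 0)⁻¹⁻¹ ∈ _
      rw [hc.inv_left.eq, mul_inv_cancel_right]
      exact lastGen_mem 2

theorem conj_s_one_mem (j : Fin 3) : s 4 1 * lastGen 3 j * (s 4 1)⁻¹ ∈ lastStrandSubgroup ∧
    (s 4 1)⁻¹ * lastGen 3 j * (s 4 1)⁻¹⁻¹ ∈ lastStrandSubgroup := by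
  have h2 : s 4 1 * s 4 2 * s 4 1 = _ := s_braid (n := 4) (i := 1) (by omega)
  have h3 : s 4 0 * s 4 2 = _ := s_comm (n := 4) (i := 0) le_rfl
  have k1 := braid_conj_first (a := s 4 1) (b := s 4 2) (d := 1) h2 (by simp)
  have k2 := braid_conj_first_mul (a := s 4 1) (b := s 4 2) (d := 1) h2 (by simp)
  simp only [one_mul, inv_one, mul_one] at k1 k2
  have key := conj_mem_of_conj_eq (a := s 4 1) (lastGen_mem 1) (lastGen_mem 2)
    (by rw [lastGen_three_one, lastGen_three_two]; exact k1)
    (by rw [lastGen_three_one, lastGen_three_two]; exact k2)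
  fin_cases j
  · have hc : s 4 1 * lastGen 3 0 = (lastGen 3 0 : Braid 4) * s 4 1 := by
      rw [← mul_inv_eq_iff_eq_mul, lastGen_three_zero]
      exact braid_conj_far h2 h3
    constructor
    · change s 4 1 * lastGen 3 0 * (s 4 1)⁻¹ ∈ _
      rw [hc, mul_inv_cancel_right]
      exact lastGen_mem 0
    · change (s 4 1)⁻¹ * lastGen 3 0 * (s 4 1)⁻¹⁻¹ ∈ _
      rw [(show Commute (s 4 1) (lastGen 3 0 : Braid 4) from hc).inv_left.eq, mul_inv_cancel_right]
      exact lastGen_mem 0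
  · exact ⟨key.1.1, key.2.1⟩
  · exact ⟨key.1.2, key.2.2⟩

/-- Braids on the first three strands normalise the subgroup of the last strand. -/
theorem addRight_conj_mem (γ : Braid 3) : ∀ y ∈ lastStrandSubgroup,
    Braid.addRight 3 γ * y * (Braid.addRight 3 γ)⁻¹ ∈ lastStrandSubgroup ∧
    (Braid.addRight 3 γ)⁻¹ * y * (Braid.addRight 3 γ)⁻¹⁻¹ ∈ lastStrandSubgroup := by
  -- Both directions of conjugation are proved at once, so that the step for inverses merely
  -- exchanges them.
  induction γ using Braid.induction with
  | one => intro y hy; simpa using hy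
  | gen i hi =>
    intro y hy
    rw [addRight_s hi]
    rcases (by omega : i = 0 ∨ i = 1) with rfl | rfl
    · exact ⟨conj_mem_lastStrandSubgroup (fun j => (conj_s_zero_mem j).1) hy,
        conj_mem_lastStrandSubgroup (fun j => (conj_s_zero_mem j).2) hy⟩
    · exact ⟨conj_mem_lastStrandSubgroup (fun j => (conj_s_one_mem j).1) hy,
        conj_mem_lastStrandSubgroup (fun j => (conj_s_one_mem j).2) hy⟩
  | mul a b ha hb =>
    intro y hy
    have h1 := (ha _ (hb y hy).1).1
    have h2 := (hb _ (ha y hy).2).2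
    rw [map_mul]
    refine ⟨?_, ?_⟩
    · convert h1 using 1; group
    · convert h2 using 1; group
  | inv a ha =>
    intro y hy
    rw [map_inv]
    exact ⟨(ha y hy).2, by simpa using (ha y hy).1⟩

/-- The product of the subgroup of the last strand and the braids on the first three. -/
def lastStrandProduct : Subgroup (Braid 4) where
  carrier := {β | ∃ r ∈ lastStrandSubgroup, ∃ γ : Braid 3, β = r * Braid.addRight 3 γ}
  one_mem' := ⟨1, one_mem _, 1, by simp⟩
  mul_mem' := by
    rintro _ _ ⟨r, hr, γ, rfl⟩ ⟨r', hr', γ', rfl⟩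
    refine ⟨_, mul_mem hr (addRight_conj_mem γ r' hr').1, γ * γ', ?_⟩
    rw [map_mul]; group
  inv_mem' := by
    rintro _ ⟨r, hr, γ, rfl⟩
    refine ⟨_, (addRight_conj_mem γ _ (inv_mem hr)).2, γ⁻¹, ?_⟩
    rw [map_inv]; group

theorem lastGen_mem_product (j : Fin 3) : (lastGen 3 j : Braid 4) ∈ lastStrandProduct :=
  ⟨_, lastGen_mem j, 1, by simp⟩

theorem s_mem_product {i : ℕ} (hi : i + 1 < 3) : s 4 i ∈ lastStrandProduct :=
  ⟨1, one_mem _, s 3 i, by rw [one_mul, addRight_s hi]⟩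

/-- A braid that moves the last strand to the position `q`. -/
def moveLast (q : Fin 4) : Braid 4 :=
  ![(s 4 0)⁻¹ * (s 4 1)⁻¹ * (s 4 2)⁻¹, (s 4 1)⁻¹ * (s 4 2)⁻¹, (s 4 2)⁻¹, 1] q

/-- A Schreier argument: the braids `moveLast q` are representatives indexed by the position of the
last strand. For each generator the corrected element is 1, some A_{j4}, or a braid generator on the
first three strands. For q = 3 it shows that a braid fixing the last position lies in
`lastStrandProduct`. -/
theorem moveLast_conj_mem (β : Braid 4) : ∀ q : Fin 4,
    (moveLast (perm 4 β q))⁻¹ * β * moveLast q ∈ lastStrandProduct := by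
  have h1 : s 4 0 * s 4 1 * s 4 0 = _ := s_braid (n := 4) (i := 0) (by omega)
  have h2 : s 4 1 * s 4 2 * s 4 1 = _ := s_braid (n := 4) (i := 1) (by omega)
  have h3 : s 4 0 * s 4 2 = _ := s_comm (n := 4) (i := 0) le_rfl
  have m0 := s_mem_product (i := 0) (by omega)
  have m1 := s_mem_product (i := 1) (by omega)
  have l0 := lastGen_mem_product 0
  have l1 := lastGen_mem_product 1
  have l2 := lastGen_mem_product 2
  rw [lastGen_three_zero] at l0
  rw [lastGen_three_one] at l1
  rw [lastGen_three_two] at l2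
  induction β using Braid.induction with
  | one => intro q; simp
  | gen i hi =>
    intro q
    rw [perm_s hi]
    obtain ⟨⟨a0, a1, a2, a3⟩, ⟨b0, b1, b2, b3⟩, d0, d1, d2, d3⟩ := tr_four_table
    have e0 : moveLast 0 = (s 4 0)⁻¹ * (s 4 1)⁻¹ * (s 4 2)⁻¹ := rfl
    have e1 : moveLast 1 = (s 4 1)⁻¹ * (s 4 2)⁻¹ := rfl
    have e2 : moveLast 2 = (s 4 2)⁻¹ := rfl
    have e3 : moveLast 3 = 1 := rfl
    generalize ha : s 4 0 = a at *
    generalize hb : s 4 1 = b at *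
    generalize hd : s 4 2 = d at *
    have f1 : d * b * d * b⁻¹ * d⁻¹ = b := by rw [← h2]; group
    have f2 : d * a * d⁻¹ = a := by rw [← h3]; group
    have f3 : d * b * a * b * a⁻¹ * b⁻¹ * d⁻¹ = a := by
      rw [show d * b * a * b * a⁻¹ * b⁻¹ * d⁻¹ = d * (b * a * b) * a⁻¹ * b⁻¹ * d⁻¹ by group, ← h1]
      refine Eq.trans ?_ f2
      group
    have f4 : d * b * a * d * a⁻¹ * b⁻¹ * d⁻¹ = b := by
      rw [show d * b * a * d * a⁻¹ * b⁻¹ * d⁻¹ = d * b * (a * d) * a⁻¹ * b⁻¹ * d⁻¹ by group, h3]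
      refine Eq.trans ?_ f1
      group
    rcases (by omega : i = 0 ∨ i = 1 ∨ i = 2) with rfl | rfl | rfl <;> fin_cases q <;>
      simp only [Fin.zero_eta, Fin.mk_one, Fin.reduceFinMk, a0, a1, a2, a3, b0, b1, b2, b3,
        d0, d1, d2, d3, e0, e1, e2, e3, ha, hb, hd]
    · convert one_mem lastStrandProduct using 1; group
    · convert l0 using 1; group
    · convert m0 using 1; refine Eq.trans ?_ f2; group
    · simpa using m0
    · convert m0 using 1; refine Eq.trans ?_ f3; group
    · convert one_mem lastStrandProduct using 1; group
    · convert l1 using 1; group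
    · simpa using m1
    · convert m1 using 1; refine Eq.trans ?_ f4; group
    · convert m1 using 1; refine Eq.trans ?_ f1; group
    · convert one_mem lastStrandProduct using 1; group
    · simpa using l2
  | mul a b ha hb =>
    intro q
    have := mul_mem (ha (perm 4 b q)) (hb q)
    convert this using 1
    rw [map_mul, Equiv.Perm.mul_apply]; group
  | inv a ha =>
    intro q
    have := inv_mem (ha ((perm 4 a)⁻¹ q))
    convert this using 1
    rw [map_inv, Equiv.Perm.coe_inv, Equiv.apply_symm_apply]; group

theorem delete_last_ofFree (w : FreeGroup (Fin 3)) : delete (Fin.last 3) (ofFree 3 w) = 1 := by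
  have : (delete (Fin.last 3)).comp (ofFree 3) = 1 := by
    ext1 j
    rw [MonoidHom.comp_apply, ofFree_of]
    exact (delete_lastGen 3 j).trans (by fin_cases j <;> rfl)
  exact DFunLike.congr_fun this w

/-- The kernel of the deletion of the last of four strands is generated by the `lastGen 3 j`. -/
theorem freeKernel_three : freeKernel 3 = (ofFree 3).range := by
  apply le_antisymm
  · intro β hβ
    have h1 := moveLast_conj_mem β 3
    have hp : perm 4 (β : Braid 4) = 1 := β.2
    rw [hp] at h1
    obtain ⟨r, hr, γ, e⟩ : (β : Braid 4) ∈ lastStrandProduct := by simpa [moveLast] using h1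
    obtain ⟨_, ⟨w, rfl⟩, rfl⟩ := hr
    have h2 : (del 3 (β : Braid 4)).left (Fin.last 3) = 1 := congrArg Subtype.val hβ
    have h3 : (del 3 (ofFree 3 w : Braid 4)).left (Fin.last 3) = 1 :=
      congrArg Subtype.val (delete_last_ofFree w)
    have h4 : perm 4 (ofFree 3 w : Braid 4) = 1 := (ofFree 3 w).2
    refine ⟨w, Subtype.ext ?_⟩
    rw [e] at h2
    change (del 3 ((ofFree 3 w : Braid 4) * _)).left _ = 1 at h2
    -- Deleting the last strand kills the free part and returns γ, so γ = 1 and only the free part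
    -- remains.
    rw [del_mul, h3, h4, one_mul, inv_one, Equiv.Perm.one_apply, del_addRight_last] at h2
    rw [e, h2, map_one, mul_one]
    rfl
  · rintro _ ⟨w, rfl⟩
    exact delete_last_ofFree w

end PureBraid

/-! ### Strand operations on pure braids -/

namespace PureBraid

open Braid

variable {n : ℕ}

theorem delete_zero_addLeft (β : PureBraid n) : delete 0 (addLeft β) = β :=
  Subtype.ext (del_addLeft_zero (β : Braid n))

theorem delete_succ_addLeft (q : Fin (n + 1)) (β : PureBraid (n + 1)) :
    delete q.succ (addLeft β) = addLeft (delete q β) :=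
  Subtype.ext (del_addLeft_succ (β : Braid (n + 1)) q)

theorem delete_last_addRight (β : PureBraid n) : delete (Fin.last n) (addRight β) = β :=
  Subtype.ext (del_addRight_last (β : Braid n))

theorem delete_castSucc_addRight (q : Fin (n + 1)) (β : PureBraid (n + 1)) :
    delete q.castSucc (addRight β) = addRight (delete q β) :=
  Subtype.ext (del_addRight_castSucc (β : Braid (n + 1)) q)

theorem delete_castSucc_double (q : Fin n) (β : PureBraid n) :
    delete q.castSucc (double q β) = β :=
  Subtype.ext (del_dbl_castSucc (β : Braid n) q)

theorem delete_succ_double (q : Fin n) (β : PureBraid n) :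
    delete q.succ (double q β) = β :=
  Subtype.ext (del_dbl_succ (β : Braid n) q)

theorem delete_double (r : Fin (n + 1)) (q : Fin n) (β : PureBraid (n + 1)) :
    delete ((r.succAbove q).succ.succAbove r) (double (r.succAbove q) β) =
      double q (delete r β) :=
  Subtype.ext (del_dbl (β : Braid (n + 1)) r q)

instance : Subsingleton (Braid 1) := by
  refine subsingleton_of_forall_eq 1 fun β => ?_
  induction β using Braid.induction with
  | one => rfl
  | gen i hi => omega
  | mul a b ha hb => rw [ha, hb, one_mul]
  | inv a ha => rw [ha, inv_one]

theorem braid_two_eq_zpow (β : Braid 2) : ∃ z : ℤ, β = s 2 0 ^ z := by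
  induction β using Braid.induction with
  | one => exact ⟨0, rfl⟩
  | gen i hi => exact ⟨1, by rw [zpow_one, show i = 0 by omega]⟩
  | mul a b ha hb =>
    obtain ⟨x, rfl⟩ := ha
    obtain ⟨y, rfl⟩ := hb
    exact ⟨x + y, (zpow_add _ _ _).symm⟩
  | inv a ha =>
    obtain ⟨x, rfl⟩ := ha
    exact ⟨-x, (zpow_neg _ _).symm⟩

end PureBraid

/-! ### The pentagon braid without one strand -/

namespace PaB

open PureBraid

variable (Φ : Hom left3 right3)

theorem delete_zero_pent : delete 0 (Pent Φ) =
    toPure Φ * double 0 (delete 0 (toPure Φ)) * addRight (delete 0 (toPure Φ)) *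
      (toPure Φ)⁻¹ * (double 1 (delete 0 (toPure Φ)))⁻¹ := by
  have h1 : delete 0 (addLeft (toPure Φ)) = _ := delete_zero_addLeft _
  have h2 : delete 0 (double 1 (toPure Φ)) = double 0 (delete 0 (toPure Φ)) := delete_double 0 0 _
  have h3 : delete 0 (addRight (toPure Φ)) = addRight (delete 0 (toPure Φ)) :=
    delete_castSucc_addRight 0 _
  have h4 : delete 0 (double 0 (toPure Φ)) = _ := delete_castSucc_double 0 _
  have h5 : delete 0 (double 2 (toPure Φ)) = double 1 (delete 0 (toPure Φ)) := delete_double 0 1 _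
  simp only [Pent, map_mul, map_inv, h1, h2, h3, h4, h5]

theorem delete_one_pent : delete 1 (Pent Φ) =
    addLeft (delete 0 (toPure Φ)) * toPure Φ * addRight (delete 1 (toPure Φ)) *
      (toPure Φ)⁻¹ * (double 1 (delete 1 (toPure Φ)))⁻¹ := by
  have h1 : delete 1 (addLeft (toPure Φ)) = addLeft (delete 0 (toPure Φ)) :=
    delete_succ_addLeft 0 _
  have h2 : delete 1 (double 1 (toPure Φ)) = _ := delete_castSucc_double 1 _
  have h3 : delete 1 (addRight (toPure Φ)) = addRight (delete 1 (toPure Φ)) :=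
    delete_castSucc_addRight 1 _
  have h4 : delete 1 (double 0 (toPure Φ)) = _ := delete_succ_double 0 _
  have h5 : delete 1 (double 2 (toPure Φ)) = double 1 (delete 1 (toPure Φ)) := delete_double 1 1 _
  simp only [Pent, map_mul, map_inv, h1, h2, h3, h4, h5]

theorem delete_two_pent : delete 2 (Pent Φ) =
    addLeft (delete 1 (toPure Φ)) * toPure Φ * addRight (delete 2 (toPure Φ)) *
      (double 0 (delete 1 (toPure Φ)))⁻¹ * (toPure Φ)⁻¹ := by
  have h1 : delete 2 (addLeft (toPure Φ)) = addLeft (delete 1 (toPure Φ)) :=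
    delete_succ_addLeft 1 _
  have h2 : delete 2 (double 1 (toPure Φ)) = _ := delete_succ_double 1 _
  have h3 : delete 2 (addRight (toPure Φ)) = addRight (delete 2 (toPure Φ)) :=
    delete_castSucc_addRight 2 _
  have h4 : delete 2 (double 0 (toPure Φ)) = double 0 (delete 1 (toPure Φ)) := delete_double 1 0 _
  have h5 : delete 2 (double 2 (toPure Φ)) = _ := delete_castSucc_double 2 _
  simp only [Pent, map_mul, map_inv, h1, h2, h3, h4, h5]

theorem delete_three_pent : delete 3 (Pent Φ) =
    addLeft (delete 2 (toPure Φ)) * double 1 (delete 2 (toPure Φ)) * toPure Φ *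
      (double 0 (delete 2 (toPure Φ)))⁻¹ * (toPure Φ)⁻¹ := by
  have h1 : delete 3 (addLeft (toPure Φ)) = addLeft (delete 2 (toPure Φ)) :=
    delete_succ_addLeft 2 _
  have h2 : delete 3 (double 1 (toPure Φ)) = double 1 (delete 2 (toPure Φ)) := delete_double 2 1 _
  have h3 : delete 3 (addRight (toPure Φ)) = _ := delete_last_addRight _
  have h4 : delete 3 (double 0 (toPure Φ)) = double 0 (delete 2 (toPure Φ)) := delete_double 2 0 _
  have h5 : delete 3 (double 2 (toPure Φ)) = _ := delete_succ_double 2 _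
  simp only [Pent, map_mul, map_inv, h1, h2, h3, h4, h5]

/-- If the pentagon braid becomes trivial when the last strand is deleted, then the first two
strands of `Φ` are not linked. -/
theorem delete_two_eq_one (h : delete 3 (Pent Φ) = 1) : delete 2 (toPure Φ) = 1 := by
  -- After this second deletion, the factors with an added left strand and with doubled strand 0
  -- come from one-strand braids and vanish. What is left is x · x · x⁻¹ for x = `delete 2 (toPure
  -- Φ)`.
  have h' := congrArg (delete 2) h
  have h1 : ∀ x : PureBraid 2, delete 2 (addLeft x) = addLeft (delete 1 x) :=
    delete_succ_addLeft 1
  have h2 : ∀ x : PureBraid 2, delete 2 (double 1 x) = x := delete_succ_double 1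
  have h4 : ∀ x : PureBraid 2, delete 2 (double 0 x) = double 0 (delete 1 x) := delete_double 1 0
  rw [delete_three_pent] at h'
  simp only [map_mul, map_inv, h1, h2, h4, map_one,
    Subsingleton.elim (delete 1 (delete 2 (toPure Φ))) 1] at h'
  simpa using h'

/-- For `i < 3`, the pentagon braid without the strand `i` is trivial if all its strands are
pairwise unlinked, provided the pentagon braid is trivial without the last strand. -/
theorem delete_pent_eq_one (h : delete 3 (Pent Φ) = 1) (i : Fin 3)
    (hi : ∀ q : Fin 3, delete q (delete i.castSucc (Pent Φ)) = 1) :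
    delete i.castSucc (Pent Φ) = 1 := by
  have ha := delete_two_eq_one Φ h
  have l0 : ∀ x : PureBraid 2, delete 0 (addLeft x) = x := delete_zero_addLeft
  have l1 : ∀ x : PureBraid 2, delete 1 (addLeft x) = 1 := fun x => by
    rw [show delete 1 (addLeft x) = addLeft (delete 0 x) from delete_succ_addLeft 0 x,
      Subsingleton.elim (delete 0 x) 1, map_one]
  have r0 : ∀ x : PureBraid 2, delete 0 (addRight x) = 1 := fun x => by
    rw [show delete 0 (addRight x) = addRight (delete 0 x) from delete_castSucc_addRight 0 x,
      Subsingleton.elim (delete 0 x) 1, map_one]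
  have r1 : ∀ x : PureBraid 2, delete 1 (addRight x) = 1 := fun x => by
    rw [show delete 1 (addRight x) = addRight (delete 1 x) from delete_castSucc_addRight 1 x,
      Subsingleton.elim (delete 1 x) 1, map_one]
  have d00 : ∀ x : PureBraid 2, delete 0 (double 0 x) = x := delete_castSucc_double 0
  have d10 : ∀ x : PureBraid 2, delete 1 (double 0 x) = x := delete_succ_double 0
  have d11 : ∀ x : PureBraid 2, delete 1 (double 1 x) = x := delete_castSucc_double 1
  have d01 : ∀ x : PureBraid 2, delete 0 (double 1 x) = 1 := fun x => by
    rw [show delete 0 (double 1 x) = double 0 (delete 0 x) from delete_double 0 0 x,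
      Subsingleton.elim (delete 0 x) 1, map_one]
  -- In each case one or two further deletions isolate the two-strand braids that occur. Once these
  -- are trivial, only Φ Φ⁻¹ is left.
  fin_cases i
  · change delete 0 (Pent Φ) = 1
    have h0 : delete 0 (delete 0 (Pent Φ)) = 1 := hi 0
    rw [delete_zero_pent] at h0 ⊢
    simp only [map_mul, map_inv, r0, d00, d01, mul_one, inv_one, mul_inv_cancel_right] at h0
    rw [h0]
    simp
  · change delete 1 (Pent Φ) = 1
    have h0 : delete 0 (delete 1 (Pent Φ)) = 1 := hi 0
    have h1 : delete 1 (delete 1 (Pent Φ)) = 1 := hi 1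
    rw [delete_one_pent] at h0 h1 ⊢
    simp only [map_mul, map_inv, r0, l0, d01, mul_one, inv_one, mul_inv_cancel_right] at h0
    simp only [map_mul, map_inv, r1, l1, d11, one_mul, mul_one, mul_inv_cancel, inv_eq_one] at h1
    rw [h0, h1]
    simp
  · change delete 2 (Pent Φ) = 1
    have h1 : delete 1 (delete 2 (Pent Φ)) = 1 := hi 1
    rw [delete_two_pent, ha] at h1 ⊢
    simp only [map_mul, map_inv, l1, d10, one_mul, mul_one, mul_inv_cancel, inv_eq_one,
      map_one] at h1
    rw [h1]
    simp

end PaB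

/-! ### Deletions and projections of power series -/

namespace NCSeries

/-- A homomorphism from the free group to the powers of `z` is determined by the linear
coefficients of the Magnus expansion. -/
theorem map_eq_zpow {r : ℕ} {H : Type*} [Group H] (f : FreeGroup (Fin r) →* H) (z : H)
    (m : Fin r → ℤ) (hf : ∀ j, f (FreeGroup.of j) = z ^ m j) (w : FreeGroup (Fin r)) :
    f w = z ^ (∑ j, m j * ((magnus r w : NCSeries r) - 1) [j]) := by
  induction w using FreeGroup.induction_on with
  | C1 => simp [zero_apply]
  | of i =>
    rw [hf]
    congr 1
    simp [magnus, X]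
  | inv_of i h =>
    rw [map_inv, h, ← zpow_neg, ← Finset.sum_neg_distrib]
    congr 1
    refine Finset.sum_congr rfl fun j _ => ?_
    rw [magnus_inv_apply (mem_magnusSubgroup_one _) rfl]
    ring
  | mul a b ha hb =>
    rw [map_mul, ha, hb, ← zpow_add, ← Finset.sum_add_distrib]
    congr 1
    refine Finset.sum_congr rfl fun j _ => ?_
    rw [magnus_mul_apply le_rfl (mem_magnusSubgroup_one _) (mem_magnusSubgroup_one _) rfl]
    ring

end NCSeries

namespace PureBraid

open Braid NCSeries

/-- Deleting a strand leads to B_2, which is cyclic. The composite from the free group therefore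
depends only on the exponent sums, which are the linear Magnus coefficients. -/
theorem delete_ofFree_two_eq_one {w : FreeGroup (Fin 2)}
    (h : ∀ j, ((magnus 2 w : NCSeries 2) - 1) [j] = 0) (q : Fin 3) :
    delete q (ofFree 2 w) = 1 := by
  let f : FreeGroup (Fin 2) →* Braid 2 :=
    (perm 2).ker.subtype.comp ((delete q).comp (ofFree 2))
  choose m hm using fun j => braid_two_eq_zpow (f (FreeGroup.of j))
  have := map_eq_zpow f _ m hm w
  simp only [h, mul_zero, Finset.sum_const_zero, zpow_zero] at this
  exact Subtype.ext this

/-- The effect on `freeKernel 3` of the deletion of the strand `i < 3`. -/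
def forget (i : Fin 3) : FreeGroup (Fin 3) →* FreeGroup (Fin 2) :=
  FreeGroup.lift (![![1, FreeGroup.of 0, FreeGroup.of 1], ![FreeGroup.of 0, 1, FreeGroup.of 1],
    ![FreeGroup.of 0, FreeGroup.of 1, 1]] i)

theorem delete_ofFree (i : Fin 3) (w : FreeGroup (Fin 3)) :
    delete i.castSucc (ofFree 3 w) = ofFree 2 (forget i w) := by
  have : (delete i.castSucc).comp (ofFree 3) = (ofFree 2).comp (forget i) := by
    ext1 j
    rw [MonoidHom.comp_apply, MonoidHom.comp_apply, ofFree_of, delete_lastGen, forget,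
      FreeGroup.lift_apply_of]
    fin_cases i <;> fin_cases j <;> first | exact (map_one _).symm | exact (ofFree_of 2 _).symm
  exact DFunLike.congr_fun this w

/-- Both sides are homomorphisms to the units, so comparing generators suffices: killing x_i
corresponds to sending X_i to 0, with the same renumbering of the others. -/
theorem magnus_forget (i : Fin 3) (w : FreeGroup (Fin 3)) :
    (magnus 2 (forget i w) : NCSeries 2) = pr i (magnus 3 w : NCSeries 3) := by
  have : (magnus 2).comp (forget i) =
      (Units.map (pr i : NCSeries 3 →* NCSeries 2)).comp (magnus 3) := by
    ext1 j
    refine Units.ext ?_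
    have hself : ∀ i : Fin 3, (1 : NCSeries 2) = pr i (1 + X i) := fun i => by
      rw [map_add, map_one, pr_X_self, add_zero]
    have hsucc : ∀ (i : Fin 3) (j : Fin 2), (1 + X j : NCSeries 2) = pr i (1 + X (i.succAbove j)) :=
      fun i j => by rw [map_add, map_one, pr_X_succAbove]
    have hof : ∀ j : Fin 2, (magnus 2 (FreeGroup.of j) : NCSeries 2) = 1 + X j := fun j => by
      simp [magnus]
    have hof' : (magnus 3 (FreeGroup.of j) : NCSeries 3) = 1 + X j := by simp [magnus]
    rw [MonoidHom.comp_apply, MonoidHom.comp_apply, forget, FreeGroup.lift_apply_of, Units.coe_map,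
      hof']
    fin_cases i <;> fin_cases j
    · exact hself 0
    · exact (hof 0).trans (hsucc 0 0)
    · exact (hof 1).trans (hsucc 0 1)
    · exact (hof 0).trans (hsucc 1 0)
    · exact hself 1
    · exact (hof 1).trans (hsucc 1 1)
    · exact (hof 0).trans (hsucc 2 0)
    · exact (hof 1).trans (hsucc 2 1)
    · exact hself 2
  exact congrArg Units.val (DFunLike.congr_fun this w)

theorem Γ_freeKernel_three (k : ℕ) :
    Γ k (freeKernel 3) = (LC (FreeGroup (Fin 3)) k).map (ofFree 3) := by
  rw [freeKernel_three, MonoidHom.range_eq_map, ← Γ_map]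

theorem mem_mixedBrunnian {n m : ℕ} (hnm : n + m = 4) {β : PureBraid 4} :
    β ∈ mixedBrunnian n m hnm ↔ ∀ q : Fin 4, n ≤ (q : ℕ) → delete q β = 1 := by
  simp only [mixedBrunnian, Subgroup.mem_iInf, Subtype.forall, MonoidHom.mem_ker]

end PureBraid

/-! ### Homogeneous components and the equivalence -/

namespace NCSeries

variable {r : ℕ}

theorem component_apply (k : ℕ) (f : NCSeries r) (w : List (Fin r)) :
    component k f w = if w.length = k then f w else 0 := rfl

theorem vanishBelow_iff_component {k : ℕ} {f : NCSeries r} :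
    VanishBelow k f ↔ ∀ i < k, component i f = 0 := by
  constructor
  · intro h i hi
    ext w
    rw [component_apply, zero_apply]
    split_ifs with hw
    · exact h w (hw ▸ hi)
    · rfl
  · intro h w hw
    have := congrFun (h _ hw) w
    rwa [component_apply, if_pos rfl] at this

theorem VanishBelow.succ_iff {k : ℕ} {f : NCSeries r} (h : VanishBelow k f) :
    VanishBelow (k + 1) f ↔ component k f = 0 := by
  rw [vanishBelow_iff_component] at *
  refine ⟨fun h' => h' k (Nat.lt_succ_self k), fun h' i hi => ?_⟩
  rcases (Nat.lt_succ_iff.1 hi).eq_or_lt with rfl | hi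
  · exact h'
  · exact h i hi

theorem pr_apply (i : Fin (r + 1)) (f : NCSeries (r + 1)) (w : List (Fin r)) :
    pr i f w = f (w.map i.succAbove) := rfl

theorem pr_component (i : Fin (r + 1)) (k : ℕ) (f : NCSeries (r + 1)) :
    pr i (component k f) = component k (pr i f) := by
  ext w
  simp only [pr_apply, component_apply, List.length_map]

end NCSeries

open PureBraid NCSeries in
theorem mainTheorem8 (n m k : ℕ) (hm : 1 ≤ m) (hnm : n + m = 4) (hk : 1 ≤ k)
    (Φ : PaB.Hom PaB.left3 PaB.right3) :
    (PaB.Pent Φ ∈ PureBraid.Γ k (PureBraid.freeKernel 3) ⊓ PureBraid.mixedBrunnian n m hnm ∧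
      PaB.Pent Φ ∉
        PureBraid.Γ (k + 1) (PureBraid.freeKernel 3) ⊓ PureBraid.mixedBrunnian n m hnm) ↔
    ∃ w : FreeGroup (Fin 3), PureBraid.ofFree 3 w = PaB.Pent Φ ∧
      ∃ φ : NCSeries 3, ((NCSeries.magnus 3 w : NCSeries 3) - 1).StartsWith k φ ∧
        ∀ i : Fin 3, n ≤ (i : ℕ) → NCSeries.pr i φ = 0 := by
  simp only [Γ_freeKernel_three]
  constructor
  · rintro ⟨⟨⟨w, hw, hP⟩, hB⟩, hnot⟩
    have hV : VanishBelow k ((magnus 3 w : NCSeries 3) - 1) := LC_le_magnusSubgroup hk hw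
    refine ⟨w, hP, _, ⟨vanishBelow_iff_component.1 hV, rfl, fun h0 => ?_⟩, fun i hi => ?_⟩
    -- A vanishing component of degree k would put w in Γ_{k+1} by the hard direction of Magnus'
    -- theorem, contrary to the assumption.
    · refine hnot ⟨⟨w, ?_, hP⟩, hB⟩
      have : w ∈ magnusSubgroup 3 (k + 1) := hV.succ_iff.2 h0
      rwa [magnusSubgroup_eq_LC (by omega)] at this
    · have h1 := (mem_mixedBrunnian hnm).1 hB i.castSucc hi
      rw [← hP, delete_ofFree, ← map_one (ofFree 2)] at h1
      have h2 := magnus_forget i w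
      -- Freeness of the kernel on three strands upgrades triviality of the deleted braid to
      -- triviality of `forget i w`, so `pr i` sends the full expansion to 1.
      rw [ofFree_injective 2 h1, map_one, Units.val_one] at h2
      rw [pr_component, map_sub, ← h2, map_one, sub_self]
      ext v
      rw [component_apply]
      exact ite_self _
  · rintro ⟨w, hP, φ, ⟨hV, rfl, hne⟩, hpr⟩
    rw [← vanishBelow_iff_component] at hV
    have hlast : delete 3 (PaB.Pent Φ) = 1 := hP ▸ delete_last_ofFree w
    refine ⟨⟨⟨w, (magnusSubgroup_eq_LC hk).le hV, hP⟩, ?_⟩, ?_⟩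
    · refine (mem_mixedBrunnian hnm).2 fun q hq => ?_
      induction q using Fin.lastCases with
      | last => exact hlast
      | cast i =>
        refine PaB.delete_pent_eq_one Φ hlast i fun q => ?_
        rw [← hP, delete_ofFree]
        refine delete_ofFree_two_eq_one (fun j => ?_) q
        rw [magnus_forget, ← map_one (pr i), ← map_sub]
        -- The linear coefficients after projection vanish: for k = 1 they are those of the
        -- projected leading term, for k > 1 they lie below the leading degree.
        rcases hk.eq_or_lt with rfl | hk'
        · have := congrFun (hpr i hq) [j]
          rw [pr_component, component_apply] at this
          exact (if_pos rfl).symm.trans this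
        · exact hV _ hk'
    · rintro ⟨⟨w', hw', hP'⟩, -⟩
      -- The element of Γ_{k+1} that represents Pent(Φ) must be w itself, so the easy direction of
      -- Magnus' theorem contradicts the nonzero leading term.
      rw [ofFree_injective 3 (hP'.trans hP.symm)] at hw'
      exact hne (hV.succ_iff.1 (LC_le_magnusSubgroup (by omega) hw'))
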